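/- Let $\alpha\in(0,1)$, $\gamma>1$ and $\mathcal K_1,\mathcal K_2>0$. For every $n\ge 1$ let $d=d^{(n)}$ and $m=m^{(n)}$ be natural numbers, let $\Psi_k=\Psi_k^{(n)}\in\mathbb R^{d\times d}$ ($k\ge 0$) satisfy $\sum_k\|\Psi_k\|^2<\infty$ ($\|\cdot\|$ is the operator norm), let $(\eta_t)_{t\in\mathbb Z}$, $\eta_t=\eta_t^{(n)}$, be independent centred Gaussian random vectors in $\mathbb R^d$, each with independent components of variance one, and let $X_t=X_t^{(n)}=\sum_{k\ge0}\Psi_k\eta_{t-k}$ (almost sure limit). Put $G(\theta)=\sum_{k\ge0}e^{-ik\theta}\Psi_k$ and $F(\theta)=F^{(n)}(\theta)=\sum_{t\in\mathbb Z}e^{it\theta}\,\mathrm{Cov}[X_0,X_t]$. For a Hermitian $d\times d$ matrix $A$ with eigenvalues $\lambda_1,\dots,\lambda_d$ let $\hat\mu_A=\frac1d\sum_{j}\delta_{\lambda_j}$. Assume: (A1) $\frac1{\mathcal K_1}\le \frac{d}{n^\alpha}\le\mathcal K_1$ and $\frac1{\mathcal K_1}\le\frac{m}{n^\alpha}\le\mathcal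 K_1$ for all $n\ge1$, and $d/m\to c$ as $n\to\infty$ for some $c>0$; (A2) $\|\Psi_0\|+\sum_{k\ge1}k\|\Psi_k\|\le\mathcal K_2$ and $\sum_{k\ge K}\|\Psi_k\|\le\mathcal K_2K^{-\gamma}$ for all $n,K\ge1$; (A3) for every $\theta\in[0,2\pi)$ the measures $\hat\mu_{F^{(n)}(\theta)}$ converge weakly as $n\to\infty$ to a compactly supported probability measure $H_\infty(\theta)\ne\delta_0$ on $[0,\infty)$. Define the Daniell smoothed periodogram $$S(\theta)=\frac1{2m+1}\sum_{j=-m}^m I\Big([\theta]_n+\frac{2\pi j}n\Big),\qquad I(\theta)=\frac1n\sum_{k,k'=0}^{n-1}e^{i(k'-k)\theta}X_kX_{k'}^\top,$$ where $[\theta]_n=\frac{2\pi}n\lfloor\frac{n\theta}{2\pi}+\frac12\rfloor$, and, with $\bm\eta=[\eta_0,\dots,\eta_{n-1}]$, the Fourier matrix $V=\frac1{\sqrt n}\big(e^{-2\pi i(k-1)(l-1)/n}\big)_{k,l=1}^n$ and the diagonal matrix $D_r$ with $(D_r)_{s,s}=1$ if $\mathrm{dist}(r,\,s-1+n\mathbb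 Z)\le m$ and $0$ otherwise, $$\tilde S'\Big(\frac{2\pi r}n\Big)=\frac1{2m+1}\,G\Big(\frac{2\pi r}n\Big)\,\bm\eta\,VD_rV^*\,\bm\eta^\top\,G\Big(\frac{2\pi r}n\Big)^*.$$ For probability measures on $\mathbb R$ let $d_{\mathrm{BL}}(\mu,\nu)=\sup_f|\int f\,d\mu-\int f\,d\nu|$, the supremum over all $f:\mathbb R\to\mathbb R$ that are bounded by $1$ and Lipschitz with constant $1$. Then for every $\delta>0$ and $D>0$ there is a constant $C>0$, depending only on $\delta,D,\mathcal K_1,\mathcal K_2,\alpha,\gamma$, such that for all $n\ge1$ $$\mathbb P\Big(\sup_{r\in\{0,\dots,n-1\}}d_{\mathrm{BL}}\big(\hat\mu_{S(2\pi r/n)},\hat\mu_{\tilde S'(2\pi r/n)}\big)\ \ge\ (48\mathcal K_2+20\mathcal K_2^2)\,n^{\max\left(\frac{\delta+(1-\gamma)\alpha}{1+\gamma},\ \delta+\alpha-1\right)}\Big)\le C\,n^{-D}.$$ -/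

import Mathlib

open MeasureTheory ProbabilityTheory Filter Topology
open scoped Matrix BoundedContinuousFunction Matrix.Norms.L2Operator

noncomputable section

namespace DaniellPeriodogram

/-! The norm `‖A‖` of a real or complex matrix is its operator norm for the Euclidean norm
(the scoped instances `Matrix.Norms.L2Operator`). -/

/-! ### Empirical spectral distributions and the bounded Lipschitz metric -/

open Classical in
/-- The empirical spectral distribution `(1/d) ∑ⱼ δ_{λⱼ(A)}` of a Hermitian `d × d` matrix
(by convention the zero measure if `A` is not Hermitian). -/
def esd {d : ℕ} (A : Matrix (Fin d) (Fin d) ℂ) : Measure ℝ :=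
  if hA : A.IsHermitian then
    (d : ENNReal)⁻¹ • ∑ j : Fin d, Measure.dirac (hA.eigenvalues j)
  else 0

/-- Continuous functions on the line that are bounded by `a` and Lipschitz with constant `a`. -/
def Lip (a : ℝ) : Set C(ℝ, ℝ) :=
  {f | (∀ x, |f x| ≤ a) ∧ ∀ x y, |f x - f y| ≤ a * |x - y|}

/-- The bounded Lipschitz metric (between probability measures on the line). -/
def dBL (μ ν : Measure ℝ) : ℝ :=
  ⨆ f : Lip 1, |(∫ x, f.1 x ∂μ) - ∫ x, f.1 x ∂ν|

/-- Weak convergence of a sequence of measures on the line. -/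
def WeaklyConverges (μ : ℕ → Measure ℝ) (ν : Measure ℝ) : Prop :=
  ∀ f : ℝ →ᵇ ℝ, Tendsto (fun n => ∫ x, f x ∂(μ n)) atTop (𝓝 (∫ x, f x ∂ν))

/-! ### The Daniell smoothed periodogram -/

/-- The periodogram `I(θ) = (1/n) ∑ₜ e^{itθ} ∑_{k' - k = t} X_k X_{k'}ᵀ` of a sample
`X_0, …, X_{n-1}`; the two sums together run over all pairs `(k, k')`. -/
def periodogram {d : ℕ} (n : ℕ) (X : ℤ → EuclideanSpace ℝ (Fin d)) (θ : ℝ) :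
    Matrix (Fin d) (Fin d) ℂ :=
  Matrix.of fun i j => (1 / (n : ℂ)) *
    ∑ k ∈ Finset.range n, ∑ k' ∈ Finset.range n,
      Complex.exp (Complex.I * ((k' : ℂ) - (k : ℂ)) * (θ : ℂ)) *
        ((X (k : ℤ) i : ℝ) : ℂ) * ((X (k' : ℤ) j : ℝ) : ℂ)

/-- The point `[θ]_n` of the grid `(2π/n) ℤ` that is closest to `θ`. -/
def gridPoint (n : ℕ) (θ : ℝ) : ℝ :=
  2 * Real.pi / n * (⌊(n : ℝ) * θ / (2 * Real.pi) + 1 / 2⌋ : ℤ)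

/-- The Daniell smoothed periodogram `S(θ)` with bandwidth `m`. -/
def daniell {d : ℕ} (n m : ℕ) (X : ℤ → EuclideanSpace ℝ (Fin d)) (θ : ℝ) :
    Matrix (Fin d) (Fin d) ℂ :=
  (1 / (2 * (m : ℂ) + 1)) •
    ∑ j ∈ Finset.Icc (-(m : ℤ)) (m : ℤ),
      periodogram n X (gridPoint n θ + 2 * Real.pi * (j : ℝ) / n)

/-! ### The approximating matrix -/

/-- The Fourier matrix `V` (rows and columns numbered from `0`). -/
def fourierMatrix (n : ℕ) : Matrix (Fin n) (Fin n) ℂ :=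
  Matrix.of fun k l => (1 / (Real.sqrt n : ℂ)) *
    Complex.exp (-2 * (Real.pi : ℂ) * Complex.I * (k : ℕ) * (l : ℕ) / (n : ℂ))

/-- The distance modulo `n`: `ρ_n(r, r') = dist (r, r' + n ℤ)`. -/
def rho (n : ℕ) (r r' : ℝ) : ℝ :=
  Metric.infDist r (Set.range fun z : ℤ => r' + (n : ℝ) * (z : ℝ))

open Classical in
/-- The diagonal matrix `D_r` (rows and columns numbered from `0`). -/
def bandMatrix (n m : ℕ) (r : ℕ) : Matrix (Fin n) (Fin n) ℂ :=
  Matrix.diagonal fun s => if rho n (r : ℝ) ((s : ℕ) : ℝ) ≤ (m : ℝ) then 1 else 0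

/-- The transfer function `G(θ) = ∑ₖ e^{-ikθ} Ψ_k`. -/
def transferFunction {d : ℕ} (Ψ : ℕ → Matrix (Fin d) (Fin d) ℝ) (θ : ℝ) :
    Matrix (Fin d) (Fin d) ℂ :=
  ∑' k : ℕ, Complex.exp (-(Complex.I * (k : ℂ) * (θ : ℂ))) • (Ψ k).map (fun x : ℝ => (x : ℂ))

/-- The complex `d × n` matrix with the columns `Y_0, …, Y_{n-1}`. -/
def columnMatrix {d : ℕ} (n : ℕ) (Y : ℤ → EuclideanSpace ℝ (Fin d)) :
    Matrix (Fin d) (Fin n) ℂ :=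
  Matrix.of fun i t => ((Y ((t : ℕ) : ℤ) i : ℝ) : ℂ)

/-- The approximant `(2m+1)⁻¹ G η V D_r V* ηᵀ G*` with `G = G(2πr/n)`. -/
def approximant {d : ℕ} (n m : ℕ) (Ψ : ℕ → Matrix (Fin d) (Fin d) ℝ)
    (η : ℤ → EuclideanSpace ℝ (Fin d)) (r : ℕ) : Matrix (Fin d) (Fin d) ℂ :=
  (1 / (2 * (m : ℂ) + 1)) •
    (transferFunction Ψ (2 * Real.pi * r / n) * columnMatrix n η * fourierMatrix n *
      bandMatrix n m r * (fourierMatrix n)ᴴ * (columnMatrix n η)ᵀ *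
      (transferFunction Ψ (2 * Real.pi * r / n))ᴴ)

/-! ### Assumptions -/

section Assumptions

variable {Ω : Type*} [MeasurableSpace Ω]

/-- `X` is the linear process `X_t = ∑ₖ Ψ_k η_{t-k}` (almost sure limit), where the random vectors
`η_t`, `t ∈ ℤ`, are independent, each with independent components of mean zero and variance one,
and `∑ₖ ‖Ψ_k‖² < ∞`. -/
structure IsLinearProcess {d : ℕ} (P : Measure Ω) (Ψ : ℕ → Matrix (Fin d) (Fin d) ℝ)
    (η X : ℤ → Ω → EuclideanSpace ℝ (Fin d)) : Prop where
  measurable_innovation : ∀ t, Measurable (η t)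
  indep : iIndepFun η P
  indep_components : ∀ t, iIndepFun (fun (i : Fin d) (ω : Ω) => η t ω i) P
  memLp_two : ∀ t i, MemLp (fun ω => η t ω i) 2 P
  mean_zero : ∀ t i, ∫ ω, η t ω i ∂P = 0
  variance_one : ∀ t i, variance (fun ω => η t ω i) P = 1
  summable_sq : Summable fun k => ‖Ψ k‖ ^ 2
  hasLimit : ∀ t, ∀ᵐ ω ∂P, Tendsto
    (fun N : ℕ => ∑ k ∈ Finset.range N, Matrix.toEuclideanLin (Ψ k) (η (t - (k : ℤ)) ω))
    atTop (𝓝 (X t ω))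

/-- The spectral density matrix `F(θ) = ∑_{t ∈ ℤ} e^{itθ} Cov[X_0, X_t]`. -/
def spectralDensity {d : ℕ} (P : Measure Ω) (X : ℤ → Ω → EuclideanSpace ℝ (Fin d)) (θ : ℝ) :
    Matrix (Fin d) (Fin d) ℂ :=
  Matrix.of fun i j => ∑' t : ℤ, Complex.exp (Complex.I * (t : ℂ) * (θ : ℂ)) *
    ((covariance (fun ω => X 0 ω i) (fun ω => X t ω j) P : ℝ) : ℂ)

/-- Asymptotics of dimension and bandwidth: `d ≍ n^α ≍ m` with the constant `K₁`, and `d / m`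
converges to a positive limit. -/
structure AssumptionA1 (α K₁ : ℝ) (d m : ℕ → ℕ) : Prop where
  dim_bounds : ∀ n : ℕ, 1 ≤ n → 1 / K₁ ≤ (d n : ℝ) / (n : ℝ) ^ α ∧ (d n : ℝ) / (n : ℝ) ^ α ≤ K₁
  band_bounds : ∀ n : ℕ, 1 ≤ n → 1 / K₁ ≤ (m n : ℝ) / (n : ℝ) ^ α ∧ (m n : ℝ) / (n : ℝ) ^ α ≤ K₁
  ratio : ∃ c : ℝ, 0 < c ∧ Tendsto (fun n => (d n : ℝ) / (m n : ℝ)) atTop (𝓝 c)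

/-- Limited long-range dependence, uniformly in `n`. -/
structure AssumptionA2 (γ K₂ : ℝ) {d : ℕ → ℕ}
    (Ψ : (n : ℕ) → ℕ → Matrix (Fin (d n)) (Fin (d n)) ℝ) : Prop where
  summable : ∀ n : ℕ, 1 ≤ n → Summable fun k : ℕ => (k : ℝ) * ‖Ψ n k‖
  weighted_bound : ∀ n : ℕ, 1 ≤ n → ‖Ψ n 0‖ + ∑' k : ℕ, (k : ℝ) * ‖Ψ n k‖ ≤ K₂
  tail_bound : ∀ n : ℕ, 1 ≤ n → ∀ K : ℕ, 1 ≤ K →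
    ∑' k : ℕ, ‖Ψ n (K + k)‖ ≤ K₂ * (K : ℝ) ^ (-γ)

/-- Convergence of the population spectral distribution at every frequency, to a compactly
supported probability measure on `[0, ∞)` other than `δ_0`. -/
def AssumptionA3 (P : Measure Ω) {d : ℕ → ℕ}
    (X : (n : ℕ) → ℤ → Ω → EuclideanSpace ℝ (Fin (d n))) : Prop :=
  ∀ θ : ℝ, 0 ≤ θ → θ < 2 * Real.pi →
    ∃ H : Measure ℝ, IsProbabilityMeasure H ∧ H ≠ Measure.dirac 0 ∧
      (∃ M : ℝ, H (Set.Icc 0 M)ᶜ = 0) ∧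
      WeaklyConverges (fun n => esd (spectralDensity P (X n) θ)) H

end Assumptions

end DaniellPeriodogram

end

/-!
The two matrices are sums `∑ yⱼ yⱼ*` and `∑ zⱼ zⱼ*` of `2m + 1` rank-one matrices
(`daniell_eq_outerSum`, `approximant_eq_outerSum`): up to the factor `(2m + 1)^{-1/2}`, `yⱼ` is the
discrete Fourier transform of the sample at the `j`-th frequency of the window around `2πr/n`, and
`zⱼ` is `G(2πr/n)` times the transform of the innovations at that frequency.

*Spectra.* If `u`, `v` are eigenbases of two Hermitian matrices, the weights `|⟪uᵢ, vⱼ⟫|²` are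
doubly stochastic, hence couple the two spectral distributions. For `A = ∑ yⱼ yⱼ*` and
`B = ∑ zⱼ zⱼ*` one has `(λᵢ - μⱼ) ⟪uᵢ, vⱼ⟫ = ⟪uᵢ, (A - B) vⱼ⟫`, and as the vectors `(⟪yₜ, uᵢ⟫)ₜ` are
orthogonal for different `i`, Bessel's inequality bounds the transport cost of this coupling by
`(‖y‖ + ‖z‖) ‖y - z‖` in Hilbert–Schmidt norms (`dBL_esd_outerSum_le`). So neither operator norms of
random matrices nor ranks of perturbations are needed.

*Columns.* The transform of `X` at a Fourier frequency differs from `G` times the transform of `η`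
by boundary terms only (`norm_dft_sub_transferFunction_le`), which are dominated by
`n^{-1/2} ∑ₖ ‖Ψ_k‖ ∑_{1 ≤ j ≤ k} (‖η_{-j}‖ + ‖η_{n-j}‖)` and hence are of order `(d/n)^{1/2}`, as
`∑ k ‖Ψ_k‖` is bounded. The same assumption makes `G` Lipschitz, so that replacing `G` at the
frequencies of the window by `G(2πr/n)` costs the factor `m/n ≍ n^{α-1}`.

*Probability.* All moments of these quantities are bounded by those of a standard normal variable,
by Minkowski's inequality and since linear combinations of the innovations are normal. Markov's
inequality for a high moment and a union bound over the `n` frequencies give the distance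
`n^{max(-1/2, α-1) + o(1)}` outside an event of probability `O(n^{-D})`. As `γ > 1`, this rate is
faster than the claimed one by a power of `n` (`exponent_le`), which for large `n` absorbs all
constants; small `n` are covered by the choice of `C`.
-/

noncomputable section

namespace DaniellPeriodogram

/-! ### Spectra of sums of rank-one matrices -/

section Spectral

open scoped InnerProductSpace

/-- Bessel's inequality for an orthogonal family that is not normalised; the terms with `p i = 0`
vanish. -/
lemma sum_sq_inner_div_norm_le {H κ : Type*} [NormedAddCommGroup H] [InnerProductSpace ℂ H]
    [Fintype κ] (p : κ → H) (hp : ∀ i k, i ≠ k → ⟪p i, p k⟫_ℂ = 0) (q : H) :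
    ∑ i, (‖⟪p i, q⟫_ℂ‖ / ‖p i‖) ^ 2 ≤ ‖q‖ ^ 2 := by
  classical
  let e : {i // p i ≠ 0} → H := fun i => ((‖p i‖⁻¹ : ℝ) : ℂ) • p i
  have he : Orthonormal ℂ e := by
    refine ⟨fun i => ?_, fun i k hik => ?_⟩
    · have : ‖p i‖ ≠ 0 := norm_ne_zero_iff.2 i.2
      simp [e, norm_smul, this]
    · simp [e, inner_smul_left, inner_smul_right, hp i k (fun h => hik (Subtype.ext h))]
  have h := he.sum_inner_products_le (x := q) (s := Finset.univ)
  refine le_trans (le_of_eq ?_) h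
  rw [← Finset.sum_filter_of_ne (p := fun i => p i ≠ 0) (fun i _ hi h0 => hi (by simp [h0])),
    Finset.sum_subtype (p := fun i => p i ≠ 0) _ (by simp)]
  refine Finset.sum_congr rfl fun i _ => ?_
  simp [e, inner_smul_left, div_eq_inv_mul]

variable {d : ℕ} {ι : Type*} [Fintype ι]

/-- The matrix `∑ᵢ yᵢ yᵢ*`. -/
def outerSum (y : ι → EuclideanSpace ℂ (Fin d)) : Matrix (Fin d) (Fin d) ℂ :=
  Matrix.of fun a b => ∑ i, y i a * star (y i b)

lemma isHermitian_outerSum (y : ι → EuclideanSpace ℂ (Fin d)) : (outerSum y).IsHermitian := by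
  ext a b
  simp [outerSum, mul_comm]

lemma inner_outerSum_mulVec (y : ι → EuclideanSpace ℂ (Fin d)) (u v : EuclideanSpace ℂ (Fin d)) :
    ⟪u, WithLp.toLp 2 (outerSum y *ᵥ v.ofLp)⟫_ℂ = ∑ i, ⟪u, y i⟫_ℂ * ⟪y i, v⟫_ℂ := by
  simp only [PiLp.inner_apply, outerSum, Matrix.mulVec, dotProduct, Matrix.of_apply,
    RCLike.inner_apply, Finset.sum_mul, Finset.mul_sum]
  rw [Finset.sum_congr rfl fun a _ => Finset.sum_comm, Finset.sum_comm]
  refine Finset.sum_congr rfl fun i _ => ?_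
  rw [Finset.sum_comm]
  refine Finset.sum_congr rfl fun a _ => Finset.sum_congr rfl fun b _ => ?_
  simp
  ring

lemma outerSum_mulVec_eigenvector (y : ι → EuclideanSpace ℂ (Fin d)) (j : Fin d) :
    WithLp.toLp 2 (outerSum y *ᵥ ((isHermitian_outerSum y).eigenvectorBasis j).ofLp) =
      ((isHermitian_outerSum y).eigenvalues j : ℂ) • (isHermitian_outerSum y).eigenvectorBasis j := by
  rw [(isHermitian_outerSum y).mulVec_eigenvectorBasis j]
  ext a; simp

/-- The bound behind the comparison of two spectra: `uᵢ` are eigenvectors of `∑ yₜ yₜ*`, which makes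
the vectors `(⟪yₜ, uᵢ⟫)ₜ` orthogonal, so that Bessel's inequality applies to them. -/
lemma sum_norm_inner_mul_le (y w : ι → EuclideanSpace ℂ (Fin d))
    (v : OrthonormalBasis (Fin d) ℂ (EuclideanSpace ℂ (Fin d))) :
    ∑ i, ∑ j, ‖⟪(isHermitian_outerSum y).eigenvectorBasis i, v j⟫_ℂ‖ *
        ‖∑ t, ⟪(isHermitian_outerSum y).eigenvectorBasis i, y t⟫_ℂ * ⟪w t, v j⟫_ℂ‖ ≤
      √(∑ t, ‖y t‖ ^ 2) * √(∑ t, ‖w t‖ ^ 2) := by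
  set u := (isHermitian_outerSum y).eigenvectorBasis with hu
  let p : Fin d → EuclideanSpace ℂ ι := fun i => WithLp.toLp 2 fun t => ⟪y t, u i⟫_ℂ
  let q : Fin d → EuclideanSpace ℂ ι := fun j => WithLp.toLp 2 fun t => ⟪w t, v j⟫_ℂ
  have hpq : ∀ i j, ∑ t, ⟪u i, y t⟫_ℂ * ⟪w t, v j⟫_ℂ = ⟪p i, q j⟫_ℂ := by
    intro i j
    simp [p, q, PiLp.inner_apply, mul_comm]
  have hpp : ∀ i k, i ≠ k → ⟪p i, p k⟫_ℂ = 0 := by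
    intro i k hik
    have h1 : ⟪p i, p k⟫_ℂ = ∑ t, ⟪u i, y t⟫_ℂ * ⟪y t, u k⟫_ℂ := by
      simp [p, PiLp.inner_apply, mul_comm]
    rw [h1, ← inner_outerSum_mulVec, outerSum_mulVec_eigenvector, inner_smul_right,
      u.orthonormal.2 hik, mul_zero]
  have hp2 : ∑ i, ‖p i‖ ^ 2 = ∑ t, ‖y t‖ ^ 2 := by
    simp only [p, EuclideanSpace.norm_sq_eq]
    rw [Finset.sum_comm]
    refine Finset.sum_congr rfl fun t _ => ?_
    rw [← EuclideanSpace.norm_sq_eq, ← u.sum_sq_norm_inner_left (y t)]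
  have hq2 : ∑ j, ‖q j‖ ^ 2 = ∑ t, ‖w t‖ ^ 2 := by
    simp only [q, EuclideanSpace.norm_sq_eq]
    rw [Finset.sum_comm]
    refine Finset.sum_congr rfl fun t _ => ?_
    rw [← EuclideanSpace.norm_sq_eq, ← v.sum_sq_norm_inner_left (w t)]
  have hsplit : ∀ i j, ‖⟪u i, v j⟫_ℂ‖ * ‖∑ t, ⟪u i, y t⟫_ℂ * ⟪w t, v j⟫_ℂ‖ =
      (‖p i‖ * ‖⟪u i, v j⟫_ℂ‖) * (‖⟪p i, q j⟫_ℂ‖ / ‖p i‖) := by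
    intro i j
    rw [hpq]
    by_cases h : p i = 0
    · simp [h]
    · have : ‖p i‖ ≠ 0 := norm_ne_zero_iff.2 h
      field_simp
  simp only [hsplit]
  rw [← Finset.sum_product', ← hp2, ← hq2]
  refine (Real.sum_mul_le_sqrt_mul_sqrt _ _ _).trans ?_
  gcongr ?_ * √?_
  · refine le_of_eq ?_
    congr 1
    rw [Finset.sum_product]
    refine Finset.sum_congr rfl fun i _ => ?_
    simp only [mul_pow]
    rw [← Finset.mul_sum, v.sum_sq_norm_inner_left (u i), u.orthonormal.1 i]
    simp
  · rw [Finset.sum_product_right]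
    exact Finset.sum_le_sum fun j _ => sum_sq_inner_div_norm_le p hpp (q j)

/-- A bound for the transport cost of the coupling `|⟪uᵢ, vⱼ⟫|²` of the two spectra. No ordering of
the eigenvalues is involved, since the weights are those of the eigenbases themselves. -/
lemma sum_sq_inner_mul_abs_eigenvalues_sub_le (y z : ι → EuclideanSpace ℂ (Fin d)) :
    ∑ i, ∑ j, ‖⟪(isHermitian_outerSum y).eigenvectorBasis i,
          (isHermitian_outerSum z).eigenvectorBasis j⟫_ℂ‖ ^ 2 *
        |(isHermitian_outerSum y).eigenvalues i - (isHermitian_outerSum z).eigenvalues j| ≤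
      (√(∑ t, ‖y t‖ ^ 2) + √(∑ t, ‖z t‖ ^ 2)) * √(∑ t, ‖y t - z t‖ ^ 2) := by
  set u := (isHermitian_outerSum y).eigenvectorBasis with hu
  set v := (isHermitian_outerSum z).eigenvectorBasis with hv
  set a := (isHermitian_outerSum y).eigenvalues with ha
  set b := (isHermitian_outerSum z).eigenvalues with hb
  have h1 := sum_norm_inner_mul_le y (fun t => y t - z t) v
  have h2 := sum_norm_inner_mul_le z (fun t => y t - z t) u
  rw [Finset.sum_comm] at h2
  rw [add_mul]
  refine le_trans ?_ (add_le_add h1 h2)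
  rw [← Finset.sum_add_distrib]
  refine Finset.sum_le_sum fun i _ => ?_
  rw [← Finset.sum_add_distrib]
  refine Finset.sum_le_sum fun j _ => ?_
  have e1 : (a i : ℂ) * ⟪u i, v j⟫_ℂ = ∑ t, ⟪u i, y t⟫_ℂ * ⟪y t, v j⟫_ℂ := by
    have := inner_outerSum_mulVec y (v j) (u i)
    rw [outerSum_mulVec_eigenvector, inner_smul_right] at this
    have := congrArg (starRingEnd ℂ) this
    simpa [mul_comm] using this
  have e2 : (b j : ℂ) * ⟪u i, v j⟫_ℂ = ∑ t, ⟪u i, z t⟫_ℂ * ⟪z t, v j⟫_ℂ := by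
    rw [← inner_outerSum_mulVec, outerSum_mulVec_eigenvector, inner_smul_right]
  -- This is `⟪uᵢ, (A - B) vⱼ⟫` with `A - B = ∑ yₜ (yₜ - zₜ)* + ∑ (yₜ - zₜ) zₜ*`.
  have e3 : ((a i - b j : ℝ) : ℂ) * ⟪u i, v j⟫_ℂ =
      (∑ t, ⟪u i, y t⟫_ℂ * ⟪y t - z t, v j⟫_ℂ) +
        (starRingEnd ℂ) (∑ t, ⟪v j, z t⟫_ℂ * ⟪y t - z t, u i⟫_ℂ) := by
    push_cast
    rw [sub_mul, e1, e2, map_sum, ← Finset.sum_sub_distrib, ← Finset.sum_add_distrib]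
    refine Finset.sum_congr rfl fun t _ => ?_
    simp only [map_mul, map_sub, inner_conj_symm, inner_sub_left]
    ring
  have e4 : |a i - b j| * ‖⟪u i, v j⟫_ℂ‖ ≤ ‖∑ t, ⟪u i, y t⟫_ℂ * ⟪y t - z t, v j⟫_ℂ‖ +
      ‖∑ t, ⟪v j, z t⟫_ℂ * ⟪y t - z t, u i⟫_ℂ‖ := by
    have := congrArg norm e3
    rw [norm_mul, Complex.norm_real, Real.norm_eq_abs] at this
    rw [this]
    refine (norm_add_le _ _).trans_eq ?_
    rw [RCLike.norm_conj]
  rw [norm_inner_symm (v j) (u i), ← mul_add]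
  calc _ = ‖⟪u i, v j⟫_ℂ‖ * (|a i - b j| * ‖⟪u i, v j⟫_ℂ‖) := by ring
    _ ≤ _ := by gcongr

/-- The rows and columns of `|⟪uᵢ, vⱼ⟫|²` sum to one, so both spectral sums are sums over pairs. -/
lemma abs_sum_lip_eigenvalues_sub_le (y z : ι → EuclideanSpace ℂ (Fin d)) (f : Lip 1) :
    |(∑ i, f.1 ((isHermitian_outerSum y).eigenvalues i)) -
        ∑ j, f.1 ((isHermitian_outerSum z).eigenvalues j)| ≤
      (√(∑ t, ‖y t‖ ^ 2) + √(∑ t, ‖z t‖ ^ 2)) * √(∑ t, ‖y t - z t‖ ^ 2) := by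
  refine le_trans ?_ (sum_sq_inner_mul_abs_eigenvalues_sub_le y z)
  set u := (isHermitian_outerSum y).eigenvectorBasis with hu
  set v := (isHermitian_outerSum z).eigenvectorBasis with hv
  set a := (isHermitian_outerSum y).eigenvalues with ha
  set b := (isHermitian_outerSum z).eigenvalues with hb
  have h1 : ∑ i, f.1 (a i) = ∑ i, ∑ j, ‖⟪u i, v j⟫_ℂ‖ ^ 2 * f.1 (a i) := by
    refine Finset.sum_congr rfl fun i _ => ?_
    rw [← Finset.sum_mul, v.sum_sq_norm_inner_left (u i), u.orthonormal.1 i]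
    simp
  have h2 : ∑ j, f.1 (b j) = ∑ i, ∑ j, ‖⟪u i, v j⟫_ℂ‖ ^ 2 * f.1 (b j) := by
    rw [Finset.sum_comm]
    refine Finset.sum_congr rfl fun j _ => ?_
    rw [← Finset.sum_mul, u.sum_sq_norm_inner_right (v j), v.orthonormal.1 j]
    simp
  rw [h1, h2, ← Finset.sum_sub_distrib]
  refine (Finset.abs_sum_le_sum_abs _ _).trans (Finset.sum_le_sum fun i _ => ?_)
  rw [← Finset.sum_sub_distrib]
  refine (Finset.abs_sum_le_sum_abs _ _).trans (Finset.sum_le_sum fun j _ => ?_)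
  rw [← mul_sub, abs_mul, abs_of_nonneg (by positivity)]
  exact mul_le_mul_of_nonneg_left ((f.2.2 (a i) (b j)).trans_eq (one_mul _)) (sq_nonneg _)

lemma integral_esd {A : Matrix (Fin d) (Fin d) ℂ} (hA : A.IsHermitian) (f : C(ℝ, ℝ)) :
    ∫ x, f x ∂(esd A) = (d : ℝ)⁻¹ * ∑ j, f (hA.eigenvalues j) := by
  rw [esd, dif_pos hA, integral_smul_measure, integral_finsetSum_measure]
  · simp
  · intro j _
    exact integrable_dirac (by simp)

/-- The bounded Lipschitz distance of the spectra of `∑ yₜ yₜ*` and `∑ zₜ zₜ*` is controlled by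
Hilbert–Schmidt norms only. -/
theorem dBL_esd_outerSum_le (y z : ι → EuclideanSpace ℂ (Fin d)) :
    dBL (esd (outerSum y)) (esd (outerSum z)) ≤
      (d : ℝ)⁻¹ * ((√(∑ t, ‖y t‖ ^ 2) + √(∑ t, ‖z t‖ ^ 2)) * √(∑ t, ‖y t - z t‖ ^ 2)) := by
  refine Real.iSup_le (fun f => ?_) (by positivity)
  rw [integral_esd (isHermitian_outerSum y), integral_esd (isHermitian_outerSum z), ← mul_sub,
    abs_mul, abs_of_nonneg (by positivity)]
  gcongr
  exact abs_sum_lip_eigenvalues_sub_le y z f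

end Spectral

/-! ### Discrete Fourier transforms of the sample -/

section Fourier

variable {d : ℕ}

/-- The complexification of a real vector. -/
def complexify (x : EuclideanSpace ℝ (Fin d)) : EuclideanSpace ℂ (Fin d) :=
  WithLp.toLp 2 fun i => (x i : ℂ)

@[simp] lemma complexify_apply (x : EuclideanSpace ℝ (Fin d)) (i : Fin d) :
    complexify x i = (x i : ℂ) := rfl

@[simp] lemma norm_complexify (x : EuclideanSpace ℝ (Fin d)) : ‖complexify x‖ = ‖x‖ := by
  simp [EuclideanSpace.norm_eq]

lemma continuous_complexify : Continuous (complexify (d := d)) := by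
  unfold complexify
  fun_prop

lemma complexify_sum {κ : Type*} (s : Finset κ) (f : κ → EuclideanSpace ℝ (Fin d)) :
    complexify (∑ k ∈ s, f k) = ∑ k ∈ s, complexify (f k) := by
  ext i; simp

lemma norm_sq_eq_re_add_im (v : EuclideanSpace ℂ (Fin d)) :
    ‖v‖ ^ 2 = ‖(WithLp.toLp 2 fun i => (v i).re : EuclideanSpace ℝ (Fin d))‖ ^ 2 +
      ‖(WithLp.toLp 2 fun i => (v i).im : EuclideanSpace ℝ (Fin d))‖ ^ 2 := by
  simp only [EuclideanSpace.norm_sq_eq, Real.norm_eq_abs, sq_abs, ← Finset.sum_add_distrib]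
  refine Finset.sum_congr rfl fun i _ => ?_
  rw [← Complex.normSq_eq_norm_sq, Complex.normSq_apply]
  ring

/-- The complexification of a real matrix. -/
def complexifyMatrix (A : Matrix (Fin d) (Fin d) ℝ) : Matrix (Fin d) (Fin d) ℂ :=
  A.map fun x : ℝ => (x : ℂ)

lemma complexify_toEuclideanLin (A : Matrix (Fin d) (Fin d) ℝ) (x : EuclideanSpace ℝ (Fin d)) :
    complexify (Matrix.toEuclideanLin A x) =
      Matrix.toEuclideanCLM (𝕜 := ℂ) (complexifyMatrix A) (complexify x) := by
  ext i
  simp [complexifyMatrix, Matrix.mulVec, dotProduct, Matrix.toEuclideanLin,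
    Matrix.ofLp_toEuclideanCLM]

/-- A real matrix acts separately on the real and the imaginary part of a complex vector. -/
lemma norm_complexifyMatrix_le (A : Matrix (Fin d) (Fin d) ℝ) : ‖complexifyMatrix A‖ ≤ ‖A‖ := by
  rw [← Matrix.l2_opNorm_toEuclideanCLM]
  refine ContinuousLinearMap.opNorm_le_bound _ (norm_nonneg _) fun v => ?_
  rw [← sq_le_sq₀ (norm_nonneg _) (by positivity), norm_sq_eq_re_add_im, mul_pow,
    norm_sq_eq_re_add_im v, mul_add, ← mul_pow, ← mul_pow]
  refine add_le_add ?_ ?_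
  · refine pow_le_pow_left₀ (norm_nonneg _) (le_trans (le_of_eq ?_) (Matrix.l2_opNorm_mulVec A _)) 2
    congr 2; ext i
    simp [complexifyMatrix, Matrix.mulVec, dotProduct, Matrix.ofLp_toEuclideanCLM]
  · refine pow_le_pow_left₀ (norm_nonneg _) (le_trans (le_of_eq ?_) (Matrix.l2_opNorm_mulVec A _)) 2
    congr 2; ext i
    simp [complexifyMatrix, Matrix.mulVec, dotProduct, Matrix.ofLp_toEuclideanCLM]

/-- The character `t ↦ e^{-itθ}`, written as in `transferFunction`. -/
def character (θ : ℝ) (t : ℕ) : ℂ := Complex.exp (-(Complex.I * (t : ℂ) * (θ : ℂ)))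

lemma character_eq_ofReal (θ : ℝ) (t : ℕ) :
    character θ t = Complex.exp ((-((t : ℝ) * θ) : ℝ) * Complex.I) := by
  rw [character]; congr 1; push_cast; ring

@[simp] lemma norm_character (θ : ℝ) (t : ℕ) : ‖character θ t‖ = 1 := by
  rw [character_eq_ofReal, Complex.norm_exp_ofReal_mul_I]

lemma character_add (θ : ℝ) (s t : ℕ) : character θ (s + t) = character θ s * character θ t := by
  rw [character, character, character, ← Complex.exp_add]; congr 1; push_cast; ring

@[simp] lemma character_zero (θ : ℝ) : character θ 0 = 1 := by simp [character]

lemma norm_character_sub_le (θ θ' : ℝ) (t : ℕ) :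
    ‖character θ t - character θ' t‖ ≤ t * |θ - θ'| := by
  have h : character θ t - character θ' t =
      character θ' t * (Complex.exp (Complex.I * (-((t : ℝ) * (θ - θ')) : ℝ)) - 1) := by
    rw [mul_sub, mul_one, character, character, ← Complex.exp_add]
    congr 2; push_cast; ring
  rw [h, norm_mul, norm_character, one_mul]
  refine (Real.norm_exp_I_mul_ofReal_sub_one_le).trans_eq ?_
  rw [norm_neg, norm_mul, Real.norm_eq_abs, Real.norm_eq_abs, abs_of_nonneg (Nat.cast_nonneg t)]

/-- The Fourier frequency `2πl/n`; the integer `l` is not reduced modulo `n`. -/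
def frequency (n : ℕ) (l : ℤ) : ℝ := 2 * Real.pi * l / n

lemma character_frequency_self {n : ℕ} (hn : 0 < n) (l : ℤ) : character (frequency n l) n = 1 := by
  have hn' : (n : ℂ) ≠ 0 := by exact_mod_cast hn.ne'
  rw [character, frequency, Complex.exp_eq_one_iff]
  refine ⟨-l, ?_⟩
  push_cast
  field_simp

lemma character_frequency_add_mul {n : ℕ} (hn : 0 < n) (l z : ℤ) (t : ℕ) :
    character (frequency n (l + n * z)) t = character (frequency n l) t := by
  have hn' : (n : ℂ) ≠ 0 := by exact_mod_cast hn.ne'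
  rw [character, character, frequency, frequency, Complex.exp_eq_exp_iff_exists_int]
  refine ⟨-(t * z), ?_⟩
  push_cast
  field_simp
  ring

/-- The discrete Fourier transform `n^{-1/2} ∑_{t<n} e^{-itθ} Y_t`. -/
def dft (n : ℕ) (Y : ℤ → EuclideanSpace ℝ (Fin d)) (θ : ℝ) : EuclideanSpace ℂ (Fin d) :=
  ((1 / √n : ℝ) : ℂ) • ∑ t ∈ Finset.range n, character θ t • complexify (Y t)

lemma dft_apply (n : ℕ) (Y : ℤ → EuclideanSpace ℝ (Fin d)) (θ : ℝ) (a : Fin d) :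
    dft n Y θ a = ((1 / √n : ℝ) : ℂ) * ∑ t ∈ Finset.range n, character θ t * (Y t a : ℂ) := by
  simp [dft]

lemma dft_frequency_add_mul {n : ℕ} (hn : 0 < n) (Y : ℤ → EuclideanSpace ℝ (Fin d)) (l z : ℤ) :
    dft n Y (frequency n (l + n * z)) = dft n Y (frequency n l) := by
  simp only [dft, character_frequency_add_mul hn]

/-- At the Fourier frequencies a shift in time multiplies the transform by a phase, up to the two
boundary terms. -/
lemma norm_dft_shift_one_sub_le {n : ℕ} (hn : 0 < n) (Y : ℤ → EuclideanSpace ℝ (Fin d)) (l : ℤ) :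
    ‖dft n (fun t => Y (t - 1)) (frequency n l) - character (frequency n l) 1 •
        dft n Y (frequency n l)‖ ≤ 1 / √n * (‖Y (-1)‖ + ‖Y (n - 1)‖) := by
  set θ := frequency n l with hθ
  have h1 : ∑ t ∈ Finset.range n, character θ t • complexify (Y ((t : ℤ) - 1)) -
      character θ 1 • ∑ t ∈ Finset.range n, character θ t • complexify (Y t) =
      complexify (Y (-1)) - complexify (Y (n - 1)) := by
    have h2 := Finset.sum_range_sub (fun t : ℕ => character θ t • complexify (Y ((t : ℤ) - 1))) n
    rw [character_frequency_self hn, Finset.sum_sub_distrib] at h2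
    rw [Finset.smul_sum]
    simp only [smul_smul, ← character_add]
    simp only [Nat.cast_add, Nat.cast_one, one_smul, character_zero,
      Nat.cast_zero, zero_sub, add_comm _ 1] at h2 ⊢
    rw [← neg_sub, ← neg_sub (complexify (Y (n - 1))), ← h2]
    simp
  rw [dft, dft, smul_comm, ← smul_sub, h1, norm_smul, Complex.norm_real, Real.norm_eq_abs,
    abs_of_nonneg (by positivity)]
  gcongr
  simpa using norm_sub_le (complexify (Y (-1))) (complexify (Y (n - 1)))

/-- Iterating the shift adds up the boundary terms; a triangle inequality is enough here, because
`∑ₖ k ‖Ψ_k‖` is finite. -/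
lemma norm_dft_shift_sub_le {n : ℕ} (hn : 0 < n) (Y : ℤ → EuclideanSpace ℝ (Fin d)) (l : ℤ)
    (k : ℕ) :
    ‖dft n (fun t => Y (t - k)) (frequency n l) - character (frequency n l) k •
        dft n Y (frequency n l)‖ ≤
      1 / √n * ∑ j ∈ Finset.range k, (‖Y (-1 - j)‖ + ‖Y (n - 1 - j)‖) := by
  induction k with
  | zero => simp
  | succ k ih =>
    have h := norm_dft_shift_one_sub_le hn (fun t => Y (t - k)) l
    rw [Finset.sum_range_succ, mul_add, add_comm (1 / √n * _)]
    have e : (fun t : ℤ => Y (t - ((k + 1 : ℕ) : ℤ))) = fun t => Y (t - 1 - k) := by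
      funext t; congr 1; push_cast; ring
    rw [e, add_comm k 1, character_add, mul_smul]
    refine (norm_sub_le_norm_sub_add_norm_sub _ (character (frequency n l) 1 •
      dft n (fun t => Y (t - k)) (frequency n l)) _).trans (add_le_add h ?_)
    rwa [← smul_sub, norm_smul, norm_character, one_mul]

lemma dft_sum_toEuclideanLin {n : ℕ} (Ψ : ℕ → Matrix (Fin d) (Fin d) ℝ)
    (η : ℤ → EuclideanSpace ℝ (Fin d)) (θ : ℝ) (N : ℕ) :
    dft n (fun t => ∑ k ∈ Finset.range N, Matrix.toEuclideanLin (Ψ k) (η (t - k))) θ =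
      ∑ k ∈ Finset.range N, Matrix.toEuclideanCLM (𝕜 := ℂ) (complexifyMatrix (Ψ k))
        (dft n (fun t => η (t - k)) θ) := by
  simp only [dft, complexify_sum, complexify_toEuclideanLin, map_smul, map_sum, Finset.smul_sum]
  rw [Finset.sum_comm]

lemma tendsto_dft (n : ℕ) (θ : ℝ) {Y : ℕ → ℤ → EuclideanSpace ℝ (Fin d)}
    {Z : ℤ → EuclideanSpace ℝ (Fin d)} (h : ∀ t, Tendsto (fun N => Y N t) atTop (𝓝 (Z t))) :
    Tendsto (fun N => dft n (Y N) θ) atTop (𝓝 (dft n Z θ)) := by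
  refine Tendsto.const_smul (tendsto_finsetSum _ fun t _ => Tendsto.const_smul ?_ _) _
  exact (continuous_complexify.tendsto _).comp (h t)

/-! ### The transfer function -/

lemma summable_norm_of_weighted {Ψ : ℕ → Matrix (Fin d) (Fin d) ℝ}
    (h : Summable fun k : ℕ => (k : ℝ) * ‖Ψ k‖) : Summable fun k => ‖Ψ k‖ := by
  rw [← summable_nat_add_iff 1] at h ⊢
  refine h.of_nonneg_of_le (fun k => norm_nonneg _) fun k => ?_
  refine le_mul_of_one_le_left (norm_nonneg _) ?_
  push_cast; linarith [(Nat.cast_nonneg k : (0 : ℝ) ≤ k)]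

lemma tsum_norm_le_weighted {Ψ : ℕ → Matrix (Fin d) (Fin d) ℝ}
    (h : Summable fun k : ℕ => (k : ℝ) * ‖Ψ k‖) :
    ∑' k, ‖Ψ k‖ ≤ ‖Ψ 0‖ + ∑' k : ℕ, (k : ℝ) * ‖Ψ k‖ := by
  rw [(summable_norm_of_weighted h).tsum_eq_zero_add, h.tsum_eq_zero_add]
  simp only [Nat.cast_zero, zero_mul, zero_add]
  refine add_le_add le_rfl (Summable.tsum_le_tsum (fun k => ?_)
    ((summable_norm_of_weighted h).comp_injective (add_left_injective 1))
    (h.comp_injective (add_left_injective 1)))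
  refine le_mul_of_one_le_left (norm_nonneg _) ?_
  push_cast
  linarith [(Nat.cast_nonneg k : (0 : ℝ) ≤ k)]

lemma summable_character_smul {Ψ : ℕ → Matrix (Fin d) (Fin d) ℝ}
    (h : Summable fun k : ℕ => (k : ℝ) * ‖Ψ k‖) (θ : ℝ) :
    Summable fun k => character θ k • complexifyMatrix (Ψ k) := by
  refine Summable.of_norm_bounded (summable_norm_of_weighted h) fun k => ?_
  rw [norm_smul, norm_character, one_mul]
  exact norm_complexifyMatrix_le _

lemma hasSum_transferFunction {Ψ : ℕ → Matrix (Fin d) (Fin d) ℝ}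
    (h : Summable fun k : ℕ => (k : ℝ) * ‖Ψ k‖) (θ : ℝ) :
    HasSum (fun k => character θ k • complexifyMatrix (Ψ k)) (transferFunction Ψ θ) :=
  (summable_character_smul h θ).hasSum

lemma norm_transferFunction_le {Ψ : ℕ → Matrix (Fin d) (Fin d) ℝ}
    (h : Summable fun k : ℕ => (k : ℝ) * ‖Ψ k‖) (θ : ℝ) :
    ‖transferFunction Ψ θ‖ ≤ ‖Ψ 0‖ + ∑' k : ℕ, (k : ℝ) * ‖Ψ k‖ := by
  refine le_trans ?_ (tsum_norm_le_weighted h)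
  rw [← (hasSum_transferFunction h θ).tsum_eq]
  refine tsum_of_norm_bounded (summable_norm_of_weighted h).hasSum fun k => ?_
  rw [norm_smul, norm_character, one_mul]
  exact norm_complexifyMatrix_le _

lemma norm_transferFunction_sub_le {Ψ : ℕ → Matrix (Fin d) (Fin d) ℝ}
    (h : Summable fun k : ℕ => (k : ℝ) * ‖Ψ k‖) (θ θ' : ℝ) :
    ‖transferFunction Ψ θ - transferFunction Ψ θ'‖ ≤
      (‖Ψ 0‖ + ∑' k : ℕ, (k : ℝ) * ‖Ψ k‖) * |θ - θ'| := by
  rw [← ((hasSum_transferFunction h θ).sub (hasSum_transferFunction h θ')).tsum_eq]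
  calc _ ≤ (∑' k : ℕ, (k : ℝ) * ‖Ψ k‖) * |θ - θ'| := by
        refine tsum_of_norm_bounded (h.hasSum.mul_right _) fun k => ?_
        rw [← sub_smul, norm_smul, mul_right_comm]
        gcongr
        · exact norm_character_sub_le _ _ _
        · exact norm_complexifyMatrix_le _
    _ ≤ _ := by gcongr; exact le_add_of_nonneg_left (norm_nonneg _)

lemma norm_toEuclideanCLM_apply_le (A : Matrix (Fin d) (Fin d) ℂ) (v : EuclideanSpace ℂ (Fin d)) :
    ‖Matrix.toEuclideanCLM (𝕜 := ℂ) A v‖ ≤ ‖A‖ * ‖v‖ := by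
  rw [← Matrix.l2_opNorm_toEuclideanCLM]
  exact ContinuousLinearMap.le_opNorm _ _

lemma tendsto_toEuclideanCLM_apply {A : ℕ → Matrix (Fin d) (Fin d) ℂ}
    {B : Matrix (Fin d) (Fin d) ℂ} (h : Tendsto A atTop (𝓝 B)) (v : EuclideanSpace ℂ (Fin d)) :
    Tendsto (fun N => Matrix.toEuclideanCLM (𝕜 := ℂ) (A N) v) atTop
      (𝓝 (Matrix.toEuclideanCLM (𝕜 := ℂ) B v)) := by
  rw [tendsto_iff_norm_sub_tendsto_zero] at h ⊢
  refine squeeze_zero (fun _ => norm_nonneg _) (fun N => ?_) (by simpa using h.mul_const ‖v‖)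
  rw [← sub_apply, ← map_sub]
  exact norm_toEuclideanCLM_apply_le _ _

/-- The boundary terms that appear when the transform of `X_t = ∑ₖ Ψ_k η_{t-k}`, cut off at
`k < N`, is replaced by the transfer function times the transform of `η`. Norms are taken termwise, which
removes the dependence on the frequency. -/
def boundaryTerm (n : ℕ) (Ψ : ℕ → Matrix (Fin d) (Fin d) ℝ) (η : ℤ → EuclideanSpace ℝ (Fin d))
    (N : ℕ) : ℝ :=
  ∑ k ∈ Finset.range N, ‖Ψ k‖ * ∑ j ∈ Finset.range k, (‖η (-1 - j)‖ + ‖η (n - 1 - j)‖)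

/-- At the Fourier frequencies the transform of the linear process is the transfer function times the
transform of the innovations, up to boundary terms. -/
lemma norm_dft_sub_transferFunction_le {n : ℕ} (hn : 0 < n) {Ψ : ℕ → Matrix (Fin d) (Fin d) ℝ}
    (h : Summable fun k : ℕ => (k : ℝ) * ‖Ψ k‖) {η X : ℤ → EuclideanSpace ℝ (Fin d)}
    (hX : ∀ t, Tendsto
      (fun N : ℕ => ∑ k ∈ Finset.range N, Matrix.toEuclideanLin (Ψ k) (η (t - (k : ℤ))))
      atTop (𝓝 (X t))) {B : ℝ} (hB : ∀ N, boundaryTerm n Ψ η N ≤ B) (l : ℤ) :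
    ‖dft n X (frequency n l) - Matrix.toEuclideanCLM (𝕜 := ℂ)
      (transferFunction Ψ (frequency n l)) (dft n η (frequency n l))‖ ≤ 1 / √n * B := by
  set θ := frequency n l with hθ
  have h1 := tendsto_dft n θ (Y := fun (N : ℕ) (t : ℤ) => ∑ k ∈ Finset.range N,
      Matrix.toEuclideanLin (Ψ k) (η (t - (k : ℤ)))) hX
  have h2 := tendsto_toEuclideanCLM_apply (hasSum_transferFunction h θ).tendsto_sum_nat
    (dft n η θ)
  refine le_of_tendsto (h1.sub h2).norm (Eventually.of_forall fun N => ?_)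
  refine le_trans ?_ (mul_le_mul_of_nonneg_left (hB N) (by positivity))
  rw [dft_sum_toEuclideanLin, map_sum, sum_apply, ← Finset.sum_sub_distrib,
    boundaryTerm, Finset.mul_sum]
  refine (norm_sum_le _ _).trans (Finset.sum_le_sum fun k _ => ?_)
  rw [map_smul, smul_apply, ← map_smul, ← map_sub, mul_left_comm]
  refine (norm_toEuclideanCLM_apply_le _ _).trans ?_
  gcongr
  · exact norm_complexifyMatrix_le _
  · exact norm_dft_shift_sub_le hn η l k

end Fourier

/-! ### The two matrices as sums of rank-one matrices -/

section Representation

variable {d : ℕ}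

/-- Integers at distance less than `m + 1` are at distance at most `m`, so that it does not matter
that `rho` is an infimum. -/
lemma rho_le_natCast_iff (n m : ℕ) (r s : ℤ) :
    rho n r s ≤ m ↔ ∃ z : ℤ, |r - (s + n * z)| ≤ m := by
  constructor
  · intro h
    have hne : (Set.range fun z : ℤ => (s : ℝ) + (n : ℝ) * (z : ℝ)).Nonempty :=
      Set.range_nonempty _
    obtain ⟨_, ⟨z, rfl⟩, hz⟩ := (Metric.infDist_lt_iff hne).1 (lt_of_le_of_lt h (lt_add_one _))
    refine ⟨z, Int.lt_add_one_iff.1 ?_⟩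
    rw [Real.dist_eq] at hz
    beta_reduce at hz
    exact_mod_cast hz
  · rintro ⟨z, hz⟩
    refine (Metric.infDist_le_dist_of_mem (Set.mem_range_self z)).trans ?_
    rw [Real.dist_eq]
    exact_mod_cast hz

open Classical in
/-- As the window is not longer than the period, summing a periodic function over the residues in
the band is summing it over the window. -/
lemma sum_band_eq_sum_window {n m : ℕ} (hnm : 2 * m + 1 ≤ n) (r : ℕ) (h : ℤ → ℂ)
    (hper : ∀ l z, h (l + n * z) = h l) :
    ∑ s : Fin n, (if rho n (r : ℝ) ((s : ℕ) : ℝ) ≤ (m : ℝ) then h ((s : ℕ) : ℤ) else 0) =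
      ∑ j ∈ Finset.Icc (-(m : ℤ)) m, h (r + j) := by
  have hn : (0 : ℤ) < n := by omega
  rw [← Finset.sum_filter]
  symm
  refine Finset.sum_bij (fun j _ => ⟨((r + j) % n).toNat, by
    have := Int.emod_nonneg (r + j) hn.ne'
    have := Int.emod_lt_of_pos (r + j) hn
    omega⟩) ?_ ?_ ?_ ?_
  · intro j hj
    have h0 := Int.emod_nonneg (r + j) hn.ne'
    rw [Finset.mem_Icc] at hj
    simp only [Finset.mem_filter, Finset.mem_univ, true_and]
    have := (rho_le_natCast_iff n m r (((r + j) % n).toNat : ℕ)).2 ⟨(r + j) / n, by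
      rw [Int.toNat_of_nonneg h0, Int.emod_add_mul_ediv, abs_le]
      omega⟩
    exact_mod_cast this
  · intro j hj j' hj' hjj
    rw [Finset.mem_Icc] at hj hj'
    have h0 := Int.emod_nonneg (r + j) hn.ne'
    have h1 := Int.emod_nonneg (r + j') hn.ne'
    have h2 : (r + j) % n = (r + j') % n := by
      have := congrArg Fin.val hjj
      simp only at this
      omega
    have h4 : (n : ℤ) ∣ (r + j) - (r + j') := Int.ModEq.dvd (Int.ModEq.symm h2)
    obtain ⟨c, hc⟩ := h4
    have h5 : |(n : ℤ) * c| < n := by rw [← hc, abs_lt]; omega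
    rw [abs_mul, abs_of_pos hn] at h5
    have h6 : |c| < 1 := by nlinarith
    have h7 : c = 0 := Int.abs_lt_one_iff.1 h6
    rw [h7] at hc
    omega
  · intro s hs
    simp only [Finset.mem_filter, Finset.mem_univ, true_and] at hs
    obtain ⟨z, hz⟩ := (rho_le_natCast_iff n m r (s : ℕ)).1 (by exact_mod_cast hs)
    refine ⟨s + n * z - r, ?_, ?_⟩
    · rw [abs_le] at hz
      rw [Finset.mem_Icc]
      omega
    · ext
      simp only [add_sub_cancel, Int.add_mul_emod_self_left]
      have : ((s : ℕ) : ℤ) % n = (s : ℕ) := Int.emod_eq_of_lt (by omega) (by have := s.2; omega)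
      rw [this]
      simp
  · intro j hj
    have h0 := Int.emod_nonneg (r + j) hn.ne'
    simp only
    rw [Int.toNat_of_nonneg h0]
    conv_lhs => rw [← Int.emod_add_mul_ediv (r + j) n, hper]

lemma gridPoint_frequency {n : ℕ} (hn : 0 < n) (r : ℕ) :
    gridPoint n (2 * Real.pi * r / n) = frequency n r := by
  have hn' : (n : ℝ) ≠ 0 := by exact_mod_cast hn.ne'
  have : (n : ℝ) * (2 * Real.pi * r / n) / (2 * Real.pi) = r := by
    field_simp
  rw [gridPoint, this]
  have h2 : ⌊(r : ℝ) + 1 / 2⌋ = (r : ℤ) := by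
    rw [Int.floor_eq_iff]; push_cast; constructor <;> linarith
  rw [h2, frequency]
  ring

lemma periodogram_apply (n : ℕ) (X : ℤ → EuclideanSpace ℝ (Fin d)) (θ : ℝ) (a b : Fin d) :
    periodogram n X θ a b = dft n X θ a * star (dft n X θ b) := by
  have hs : ((1 / √n : ℝ) : ℂ) * star ((1 / √n : ℝ) : ℂ) = 1 / (n : ℂ) := by
    rw [Complex.star_def, Complex.conj_ofReal, ← Complex.ofReal_mul, div_mul_div_comm,
      Real.mul_self_sqrt (Nat.cast_nonneg n)]
    push_cast
    simp
  rw [dft_apply, dft_apply, star_mul', mul_mul_mul_comm, hs, periodogram, Matrix.of_apply,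
    star_sum, Finset.sum_mul_sum]
  congr 1
  refine Finset.sum_congr rfl fun k _ => Finset.sum_congr rfl fun k' _ => ?_
  have hc : character θ k * star (character θ k') =
      Complex.exp (Complex.I * ((k' : ℂ) - (k : ℂ)) * (θ : ℂ)) := by
    rw [character, character, Complex.star_def, ← Complex.exp_conj, ← Complex.exp_add]
    congr 1
    simp
    ring
  rw [star_mul', mul_mul_mul_comm, hc, mul_assoc]
  simp

/-- The columns whose outer products add up to the smoothed periodogram. -/
def daniellColumn (n m : ℕ) (X : ℤ → EuclideanSpace ℝ (Fin d)) (r : ℕ)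
    (j : Finset.Icc (-(m : ℤ)) (m : ℤ)) : EuclideanSpace ℂ (Fin d) :=
  ((1 / √(2 * m + 1) : ℝ) : ℂ) • dft n X (frequency n (r + j))

/-- The columns whose outer products add up to the approximant. -/
def approximantColumn (n m : ℕ) (Ψ : ℕ → Matrix (Fin d) (Fin d) ℝ)
    (η : ℤ → EuclideanSpace ℝ (Fin d)) (r : ℕ) (j : Finset.Icc (-(m : ℤ)) (m : ℤ)) :
    EuclideanSpace ℂ (Fin d) :=
  ((1 / √(2 * m + 1) : ℝ) : ℂ) • Matrix.toEuclideanCLM (𝕜 := ℂ)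
    (transferFunction Ψ (frequency n r)) (dft n η (frequency n (r + j)))

lemma outerSum_smul_apply {ι : Type*} [Fintype ι] (m : ℕ) (y : ι → EuclideanSpace ℂ (Fin d))
    (a b : Fin d) :
    outerSum (fun i => ((1 / √(2 * m + 1) : ℝ) : ℂ) • y i) a b =
      1 / (2 * (m : ℂ) + 1) * ∑ i, y i a * star (y i b) := by
  have hs : ((1 / √(2 * m + 1) : ℝ) : ℂ) * star ((1 / √(2 * m + 1) : ℝ) : ℂ) =
      1 / (2 * (m : ℂ) + 1) := by
    rw [Complex.star_def, Complex.conj_ofReal, ← Complex.ofReal_mul, div_mul_div_comm,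
      Real.mul_self_sqrt (by positivity)]
    push_cast
    simp
  rw [outerSum, Matrix.of_apply, Finset.mul_sum]
  refine Finset.sum_congr rfl fun i _ => ?_
  rw [← hs]
  simp only [PiLp.smul_apply, smul_eq_mul, star_mul']
  ring

lemma daniell_eq_outerSum {n : ℕ} (hn : 0 < n) (m : ℕ) (X : ℤ → EuclideanSpace ℝ (Fin d)) (r : ℕ) :
    daniell n m X (2 * Real.pi * r / n) = outerSum (daniellColumn n m X r) := by
  ext a b
  unfold daniellColumn
  rw [outerSum_smul_apply, daniell, Matrix.smul_apply, Matrix.sum_apply, smul_eq_mul,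
    ← Finset.sum_coe_sort, gridPoint_frequency hn]
  congr 1
  refine Finset.sum_congr rfl fun j _ => ?_
  rw [periodogram_apply]
  have : frequency n r + 2 * Real.pi * ((j : ℤ) : ℝ) / n = frequency n (r + j) := by
    simp only [frequency]; push_cast; ring
  rw [this]

lemma columnMatrix_mul_fourierMatrix_apply {n : ℕ} (η : ℤ → EuclideanSpace ℝ (Fin d)) (a : Fin d)
    (s : Fin n) :
    (columnMatrix n η * fourierMatrix n) a s = dft n η (frequency n (s : ℕ)) a := by
  rw [Matrix.mul_apply, dft_apply, Finset.mul_sum, ← Fin.sum_univ_eq_sum_range (fun t : ℕ =>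
    ((1 / √n : ℝ) : ℂ) * (character (frequency n ((s : ℕ) : ℤ)) t * (η t a : ℂ)))]
  refine Finset.sum_congr rfl fun t _ => ?_
  rw [columnMatrix, fourierMatrix, Matrix.of_apply, Matrix.of_apply, character, frequency]
  have : -2 * (Real.pi : ℂ) * Complex.I * ((t : ℕ) : ℂ) * ((s : ℕ) : ℂ) / (n : ℂ) =
      -(Complex.I * ((t : ℕ) : ℂ) * ((2 * Real.pi * (((s : ℕ) : ℤ) : ℝ) / n : ℝ) : ℂ)) := by
    push_cast; ring
  rw [this]
  push_cast
  ring

lemma approximant_eq_outerSum {n m : ℕ} (hnm : 2 * m + 1 ≤ n) (Ψ : ℕ → Matrix (Fin d) (Fin d) ℝ)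
    (η : ℤ → EuclideanSpace ℝ (Fin d)) (r : ℕ) :
    approximant n m Ψ η r = outerSum (approximantColumn n m Ψ η r) := by
  have hn : 0 < n := by omega
  ext a b
  have hθ : 2 * Real.pi * (r : ℝ) / n = frequency n r := by simp [frequency]
  unfold approximantColumn
  rw [outerSum_smul_apply, approximant, Matrix.smul_apply, smul_eq_mul, hθ]
  congr 1
  set G := transferFunction Ψ (frequency n r) with hG
  set M := G * columnMatrix n η * fourierMatrix n with hM
  have hMH : (fourierMatrix n)ᴴ * (columnMatrix n η)ᵀ * Gᴴ = Mᴴ := by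
    have : (columnMatrix n η)ᵀ = (columnMatrix n η)ᴴ := by
      ext i j; simp [columnMatrix]
    rw [hM, this, Matrix.conjTranspose_mul, Matrix.conjTranspose_mul, Matrix.mul_assoc]
  rw [Matrix.mul_assoc (M * _ ), Matrix.mul_assoc (M * _), hMH]
  have hMa : ∀ (c : Fin d) (s : Fin n), M c s = (Matrix.toEuclideanCLM (𝕜 := ℂ) G
      (dft n η (frequency n ((s : ℕ) : ℤ)))) c := by
    intro c s
    rw [hM, Matrix.mul_assoc, Matrix.mul_apply, Matrix.ofLp_toEuclideanCLM, Matrix.mulVec,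
      dotProduct]
    refine Finset.sum_congr rfl fun e _ => ?_
    rw [columnMatrix_mul_fourierMatrix_apply]
  let h : ℤ → ℂ := fun l =>
    (Matrix.toEuclideanCLM (𝕜 := ℂ) G (dft n η (frequency n l))) a *
      star ((Matrix.toEuclideanCLM (𝕜 := ℂ) G (dft n η (frequency n l))) b)
  have key := sum_band_eq_sum_window hnm r h (fun l z => by
    simp only [h, dft_frequency_add_mul hn])
  refine Eq.trans ?_ (key.trans (Finset.sum_coe_sort _ _).symm)
  rw [Matrix.mul_apply]
  refine Finset.sum_congr rfl fun s _ => ?_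
  rw [bandMatrix, Matrix.mul_diagonal, Matrix.conjTranspose_apply, hMa, hMa]
  split_ifs <;> simp [h]

end Representation

/-! ### The deterministic comparison -/

section Deterministic

variable {d : ℕ}

/-- `2m + 1` columns of norm at most `(2m + 1)^{-1/2} a` have Hilbert–Schmidt norm at most `a`. -/
lemma sqrt_sum_sq_norm_smul_le (m : ℕ)
    (v : Finset.Icc (-(m : ℤ)) (m : ℤ) → EuclideanSpace ℂ (Fin d))
    {a : ℝ} (ha : 0 ≤ a) (hv : ∀ j, ‖v j‖ ≤ a) :
    √(∑ j, ‖((1 / √(2 * m + 1) : ℝ) : ℂ) • v j‖ ^ 2) ≤ a := by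
  rw [Real.sqrt_le_left ha]
  have hm : (0 : ℝ) < 2 * m + 1 := by positivity
  calc ∑ j, ‖((1 / √(2 * m + 1) : ℝ) : ℂ) • v j‖ ^ 2
      ≤ ∑ _j : Finset.Icc (-(m : ℤ)) (m : ℤ), 1 / (2 * m + 1) * a ^ 2 := by
        refine Finset.sum_le_sum fun j _ => ?_
        rw [norm_smul, Complex.norm_real, mul_pow, Real.norm_eq_abs, sq_abs, div_pow, one_pow,
          Real.sq_sqrt hm.le]
        gcongr
        exact hv j
    _ = a ^ 2 := by
        rw [Finset.sum_const, Finset.card_univ, Fintype.card_coe, Int.card_Icc, nsmul_eq_mul]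
        have : (m : ℤ) + 1 - -(m : ℤ) = ((2 * m + 1 : ℕ) : ℤ) := by push_cast; ring
        rw [this, Int.toNat_natCast]
        push_cast
        field_simp

/-- Comparison of the two spectra for a realisation whose boundary terms are at most `B` and
whose transforms of the innovations are at most `A`. -/
lemma dBL_daniell_approximant_le {n m : ℕ} (hnm : 2 * m + 1 ≤ n)
    {Ψ : ℕ → Matrix (Fin d) (Fin d) ℝ} {K : ℝ}
    (h : Summable fun k : ℕ => (k : ℝ) * ‖Ψ k‖) (hK : ‖Ψ 0‖ + ∑' k : ℕ, (k : ℝ) * ‖Ψ k‖ ≤ K)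
    {η X : ℤ → EuclideanSpace ℝ (Fin d)}
    (hX : ∀ t, Tendsto
      (fun N : ℕ => ∑ k ∈ Finset.range N, Matrix.toEuclideanLin (Ψ k) (η (t - (k : ℤ))))
      atTop (𝓝 (X t))) {A B : ℝ} (hB : ∀ N, boundaryTerm n Ψ η N ≤ B)
    (hA : ∀ l : ℕ, l < n → ‖dft n η (frequency n l)‖ ≤ A) (r : ℕ) :
    dBL (esd (daniell n m X (2 * Real.pi * r / n))) (esd (approximant n m Ψ η r)) ≤
      (d : ℝ)⁻¹ * ((2 * (K * A) + (1 / √n * B + K * (2 * Real.pi * m / n) * A)) *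
        (1 / √n * B + K * (2 * Real.pi * m / n) * A)) := by
  have hn : 0 < n := by omega
  have hn' : (0 : ℤ) < n := by exact_mod_cast hn
  have hA0 : 0 ≤ A := (norm_nonneg _).trans (hA 0 hn)
  have hB0 : 0 ≤ B := by simpa [boundaryTerm] using hB 0
  have hK0 : 0 ≤ K := le_trans (by positivity) hK
  -- The frequencies of the window may leave the range `0 ≤ l < n`.
  have hA' : ∀ l : ℤ, ‖dft n η (frequency n l)‖ ≤ A := by
    intro l
    have h0 := Int.emod_nonneg l hn'.ne'
    have h1 := Int.emod_lt_of_pos l hn'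
    have h2 := hA (l % n).toNat (by omega)
    rw [Int.toNat_of_nonneg h0] at h2
    rwa [← Int.emod_add_mul_ediv l n, dft_frequency_add_mul hn]
  set Δ := 1 / √n * B + K * (2 * Real.pi * m / n) * A with hΔ
  have hΔ0 : 0 ≤ Δ := by positivity
  have hz : ∀ j : Finset.Icc (-(m : ℤ)) (m : ℤ), ‖Matrix.toEuclideanCLM (𝕜 := ℂ)
      (transferFunction Ψ (frequency n r)) (dft n η (frequency n (r + j)))‖ ≤ K * A := by
    intro j
    refine (norm_toEuclideanCLM_apply_le _ _).trans ?_
    gcongr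
    · exact (norm_transferFunction_le h _).trans hK
    · exact hA' _
  have hyz : ∀ j : Finset.Icc (-(m : ℤ)) (m : ℤ), ‖dft n X (frequency n (r + j)) -
      Matrix.toEuclideanCLM (𝕜 := ℂ) (transferFunction Ψ (frequency n r))
        (dft n η (frequency n (r + j)))‖ ≤ Δ := by
    intro j
    refine (norm_sub_le_norm_sub_add_norm_sub _ (Matrix.toEuclideanCLM (𝕜 := ℂ)
      (transferFunction Ψ (frequency n (r + j))) (dft n η (frequency n (r + j)))) _).trans
      (add_le_add (norm_dft_sub_transferFunction_le hn h hX hB _) ?_)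
    rw [← sub_apply, ← map_sub]
    refine (norm_toEuclideanCLM_apply_le _ _).trans ?_
    gcongr
    · refine (norm_transferFunction_sub_le h _ _).trans ?_
      gcongr
      have hj := Finset.mem_Icc.1 j.2
      have hj' : |((j : ℤ) : ℝ)| ≤ m := by
        rw [← Int.cast_abs]
        exact_mod_cast abs_le.2 hj
      have e : frequency n (r + j) - frequency n r = 2 * Real.pi * ((j : ℤ) : ℝ) / n := by
        simp only [frequency]; push_cast; ring
      rw [e, abs_div, abs_mul, abs_of_nonneg (by positivity : (0 : ℝ) ≤ 2 * Real.pi),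
        abs_of_nonneg (Nat.cast_nonneg n : (0 : ℝ) ≤ n)]
      gcongr
    · exact hA' _
  have hy : ∀ j : Finset.Icc (-(m : ℤ)) (m : ℤ), ‖dft n X (frequency n (r + j))‖ ≤
      K * A + Δ := by
    intro j
    have := norm_le_norm_add_norm_sub' (dft n X (frequency n (r + j)))
      (Matrix.toEuclideanCLM (𝕜 := ℂ) (transferFunction Ψ (frequency n r))
        (dft n η (frequency n (r + j))))
    linarith [hz j, hyz j]
  rw [daniell_eq_outerSum hn, approximant_eq_outerSum hnm]
  refine (dBL_esd_outerSum_le _ _).trans ?_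
  have e1 := sqrt_sum_sq_norm_smul_le m _ (by positivity) hy
  have e2 := sqrt_sum_sq_norm_smul_le m _ (by positivity) hz
  have e3 := sqrt_sum_sq_norm_smul_le m _ (by positivity) hyz
  simp only [smul_sub] at e3
  refine mul_le_mul_of_nonneg_left (mul_le_mul ?_ e3 (by positivity) (by positivity))
    (by positivity)
  calc _ ≤ K * A + Δ + K * A := add_le_add e1 e2
    _ = _ := by ring

end Deterministic

/-! ### Moments of Gaussian vectors -/

section Gaussian

open scoped NNReal ENNReal

variable {Ω : Type*} [MeasurableSpace Ω] {P : Measure Ω} {d : ℕ}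

/-- The `Lᵖ` norm of a standard normal variable. -/
def gaussianNorm (p : ℝ≥0∞) : ℝ := (eLpNorm id p (gaussianReal 0 1)).toReal

lemma gaussianNorm_nonneg (p : ℝ≥0∞) : 0 ≤ gaussianNorm p := ENNReal.toReal_nonneg

lemma ofReal_gaussianNorm {p : ℝ≥0∞} (hp : p ≠ ∞) :
    ENNReal.ofReal (gaussianNorm p) = eLpNorm id p (gaussianReal 0 1) :=
  ENNReal.ofReal_toReal (memLp_id_gaussianReal' p hp).eLpNorm_lt_top.ne

lemma eLpNorm_le_of_map_eq_gaussianReal {p : ℝ≥0∞} (hp : p ≠ ∞) {U : Ω → ℝ}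
    (hU : AEMeasurable U P) {v : ℝ≥0} (hv : v ≤ 1) (h : P.map U = gaussianReal 0 v) :
    eLpNorm U p P ≤ ENNReal.ofReal (gaussianNorm p) := by
  have h1 : eLpNorm U p P = eLpNorm id p (gaussianReal 0 v) := by
    rw [← h, eLpNorm_map_measure aestronglyMeasurable_id hU]; rfl
  have h2 : gaussianReal 0 v = (gaussianReal 0 1).map (fun x : ℝ => (NNReal.sqrt v : ℝ) * x) := by
    rw [gaussianReal_map_const_mul]
    congr 1
    · simp
    · ext; simp
  rw [h1, h2, eLpNorm_map_measure aestronglyMeasurable_id (by fun_prop), ofReal_gaussianNorm hp]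
  refine eLpNorm_mono fun x => ?_
  simp only [Function.comp_apply, id, norm_mul]
  refine mul_le_of_le_one_left (norm_nonneg _) ?_
  rw [Real.norm_eq_abs, NNReal.abs_eq]
  exact_mod_cast NNReal.sqrt_le_one.2 hv

/-- No independence of the components is needed: `‖U‖² = ∑ᵢ Uᵢ²` and Minkowski's inequality in
`Lᵏ`. -/
lemma eLpNorm_euclidean_le {k : ℝ≥0∞} (hk : 1 ≤ k) {U : Ω → EuclideanSpace ℝ (Fin d)}
    (hU : ∀ i, AEStronglyMeasurable (fun ω => U ω i) P) {a : ℝ} (ha : 0 ≤ a)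
    (h : ∀ i, eLpNorm (fun ω => U ω i) (k * 2) P ≤ ENNReal.ofReal a) :
    eLpNorm U (k * 2) P ≤ ENNReal.ofReal (√d * a) := by
  have e : ∀ {E : Type} [NormedAddCommGroup E] (f : Ω → E),
      eLpNorm (fun ω => ‖f ω‖ ^ 2) k P = eLpNorm f (k * 2) P ^ 2 := by
    intro E _ f
    have := eLpNorm_norm_rpow (p := k) (μ := P) f (q := 2) (by norm_num)
    simpa using this
  have h1 : eLpNorm U (k * 2) P ^ 2 ≤ ENNReal.ofReal (√d * a) ^ 2 := by
    rw [← e U]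
    have h2 : (fun ω => ‖U ω‖ ^ 2) = ∑ i, fun ω => ‖U ω i‖ ^ 2 := by
      ext ω
      rw [EuclideanSpace.norm_sq_eq, Finset.sum_apply]
    rw [h2]
    refine (eLpNorm_sum_le (fun i _ => (hU i).norm.pow 2) hk).trans ?_
    calc _ ≤ ∑ _i : Fin d, ENNReal.ofReal a ^ 2 := by
          refine Finset.sum_le_sum fun i _ => ?_
          exact (e fun ω => U ω i).trans_le (pow_le_pow_left' (h i) 2)
      _ = _ := by
          rw [Finset.sum_const, Finset.card_univ, Fintype.card_fin, nsmul_eq_mul,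
            ← ENNReal.ofReal_pow ha, ← ENNReal.ofReal_pow (by positivity), mul_pow,
            Real.sq_sqrt (Nat.cast_nonneg d), ENNReal.ofReal_mul (by positivity),
            ENNReal.ofReal_natCast]
  exact (ENNReal.pow_le_pow_left_iff two_ne_zero).1 h1

/-- Markov's inequality for the `q`-th moment. -/
lemma measure_le_norm_le {E : Type*} [NormedAddCommGroup E] {q : ℕ} (hq : q ≠ 0) {U : Ω → E}
    (hU : AEStronglyMeasurable U P) {a x : ℝ} (ha : 0 ≤ a) (hx : 0 < x)
    (h : eLpNorm U q P ≤ ENNReal.ofReal a) :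
    P {ω | x ≤ ‖U ω‖} ≤ ENNReal.ofReal ((a / x) ^ q) := by
  have h1 := meas_ge_le_mul_pow_eLpNorm_enorm P (p := q) (by exact_mod_cast hq)
    (ENNReal.natCast_ne_top q) hU (ε := ENNReal.ofReal x) (by simpa using hx) (by simp)
  have h2 : {ω | x ≤ ‖U ω‖} = {ω | ENNReal.ofReal x ≤ ‖U ω‖ₑ} := by
    ext ω
    simp only [Set.mem_ofPred_eq]
    rw [← ofReal_norm, ENNReal.ofReal_le_ofReal_iff (norm_nonneg _)]
  rw [h2]
  refine h1.trans ?_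
  rw [ENNReal.toReal_natCast, ENNReal.rpow_natCast, ENNReal.rpow_natCast,
    ENNReal.ofReal_pow (by positivity), div_eq_inv_mul, ENNReal.ofReal_mul (by positivity),
    ENNReal.ofReal_inv_of_pos hx, mul_pow]
  gcongr

/-! ### Probability bounds for the innovations -/

variable {Ψ : ℕ → Matrix (Fin d) (Fin d) ℝ}
  {η X : ℤ → Ω → EuclideanSpace ℝ (Fin d)}

lemma IsLinearProcess.measurable_component (hL : IsLinearProcess P Ψ η X) (t : ℤ) (i : Fin d) :
    Measurable fun ω => η t ω i :=
  (EuclideanSpace.proj (𝕜 := ℝ) i).measurable.comp (hL.measurable_innovation t)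

lemma hasGaussianLaw_component (hG : ∀ t, HasGaussianLaw (η t) P) (t : ℤ) (i : Fin d) :
    HasGaussianLaw (fun ω => η t ω i) P :=
  (hG t).map_fun (EuclideanSpace.proj (𝕜 := ℝ) i)

/-- A linear combination of the `i`-th components of the innovations is a centred normal variable
with variance `∑ₜ aₜ²`. -/
lemma IsLinearProcess.map_linear_combination [IsProbabilityMeasure P]
    (hL : IsLinearProcess P Ψ η X)
    (hG : ∀ t, HasGaussianLaw (η t) P) (i : Fin d) (n : ℕ) (a : ℕ → ℝ) :
    P.map (fun ω => ∑ t ∈ Finset.range n, a t * η t ω i) =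
      gaussianReal 0 (∑ t ∈ Finset.range n, a t ^ 2).toNNReal := by
  let Z : Fin n → Ω → ℝ := fun t ω => a t * η (t : ℕ) ω i
  have hZ : (fun ω => ∑ t ∈ Finset.range n, a t * η t ω i) = fun ω => ∑ t, Z t ω := by
    funext ω
    exact (Fin.sum_univ_eq_sum_range (fun t => a t * η t ω i) n).symm
  have hind : iIndepFun Z P := by
    have h1 : iIndepFun (fun t : Fin n => η ((t : ℕ) : ℤ)) P :=
      hL.indep.precomp (g := fun t : Fin n => ((t : ℕ) : ℤ))
        (fun s t hst => Fin.ext (Int.ofNat_inj.1 hst))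
    exact h1.comp (fun t x => a t * x i) fun t =>
      ((EuclideanSpace.proj (𝕜 := ℝ) i).measurable).const_mul _
  have hgauss : HasGaussianLaw (fun ω => ∑ t, Z t ω) P := by
    have h1 := iIndepFun.hasGaussianLaw (X := Z)
      (fun t => (hasGaussianLaw_component hG (t : ℕ) i).fun_smul (a t)) hind
    have h2 := h1.map_fun (∑ t : Fin n, ContinuousLinearMap.proj (R := ℝ) (φ := fun _ => ℝ) t)
    simpa using h2
  have hint : ∀ t, MemLp (Z t) 2 P := fun t => (hL.memLp_two _ i).const_mul _
  have hmean : ∫ ω, ∑ t, Z t ω ∂P = 0 := by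
    rw [integral_finsetSum _ fun t _ => (hint t).integrable (by norm_num)]
    refine Finset.sum_eq_zero fun t _ => ?_
    simp only [Z, integral_const_mul, hL.mean_zero, mul_zero]
  have hvar : variance (fun ω => ∑ t, Z t ω) P = ∑ t ∈ Finset.range n, a t ^ 2 := by
    have h1 := IndepFun.variance_sum (X := Z) (s := Finset.univ) (fun t _ => hint t)
      (fun s _ t _ hst => hind.indepFun hst)
    have h2 : (∑ t, Z t) = fun ω => ∑ t, Z t ω := by ext ω; simp
    rw [← h2, h1, ← Fin.sum_univ_eq_sum_range (fun t => a t ^ 2)]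
    refine Finset.sum_congr rfl fun t _ => ?_
    simp only [Z, variance_const_mul, hL.variance_one, mul_one]
  rw [hZ, hgauss.map_eq_gaussianReal, hmean, hvar]

lemma IsLinearProcess.eLpNorm_innovation_le (hL : IsLinearProcess P Ψ η X)
    (hG : ∀ t, HasGaussianLaw (η t) P) {k : ℝ≥0∞} (hk : 1 ≤ k) (hk' : k ≠ ∞) (t : ℤ) :
    eLpNorm (η t) (k * 2) P ≤ ENNReal.ofReal (√d * gaussianNorm (k * 2)) := by
  refine eLpNorm_euclidean_le hk (fun i => (hL.measurable_component t i).aestronglyMeasurable)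
    (gaussianNorm_nonneg _) fun i => ?_
  refine eLpNorm_le_of_map_eq_gaussianReal (by finiteness)
    (hL.measurable_component t i).aemeasurable le_rfl ?_
  rw [(hasGaussianLaw_component hG t i).map_eq_gaussianReal, hL.mean_zero, hL.variance_one]
  simp

lemma IsLinearProcess.eLpNorm_linear_combination_le [IsProbabilityMeasure P]
    (hL : IsLinearProcess P Ψ η X)
    (hG : ∀ t, HasGaussianLaw (η t) P) {k : ℝ≥0∞} (hk : 1 ≤ k) (hk' : k ≠ ∞) (n : ℕ) (a : ℕ → ℝ)
    (ha : ∑ t ∈ Finset.range n, a t ^ 2 ≤ 1) :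
    eLpNorm (fun ω => (WithLp.toLp 2 fun i => ∑ t ∈ Finset.range n, a t * η t ω i :
      EuclideanSpace ℝ (Fin d))) (k * 2) P ≤ ENNReal.ofReal (√d * gaussianNorm (k * 2)) := by
  have hm : ∀ i, Measurable fun ω => ∑ t ∈ Finset.range n, a t * η t ω i := fun i =>
    Finset.measurable_fun_sum _ fun t _ => (hL.measurable_component t i).const_mul _
  refine eLpNorm_euclidean_le hk (fun i => (hm i).aestronglyMeasurable)
    (gaussianNorm_nonneg _) fun i => ?_
  exact eLpNorm_le_of_map_eq_gaussianReal (by finiteness) (hm i).aemeasurable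
    (Real.toNNReal_le_one.2 ha) (hL.map_linear_combination hG i n a)

/-- The real and the imaginary part of the transform are Gaussian vectors whose components have
variance at most one. -/
lemma IsLinearProcess.eLpNorm_dft_le [IsProbabilityMeasure P]
    (hL : IsLinearProcess P Ψ η X)
    (hG : ∀ t, HasGaussianLaw (η t) P) {k : ℝ≥0∞} (hk : 1 ≤ k) (hk' : k ≠ ∞) (n : ℕ) (θ : ℝ) :
    eLpNorm (fun ω => dft n (fun t => η t ω) θ) (k * 2) P ≤
      ENNReal.ofReal (2 * (√d * gaussianNorm (k * 2))) := by
  let a : ℕ → ℝ := fun t => 1 / √n * (character θ t).re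
  let b : ℕ → ℝ := fun t => 1 / √n * (character θ t).im
  have hsq : ∀ c : ℕ → ℝ, (∀ t, |c t| ≤ 1) →
      ∑ t ∈ Finset.range n, (1 / √n * c t) ^ 2 ≤ 1 := by
    intro c hc
    calc ∑ t ∈ Finset.range n, (1 / √n * c t) ^ 2 ≤ ∑ _t ∈ Finset.range n, 1 / (n : ℝ) := by
          refine Finset.sum_le_sum fun t _ => ?_
          rw [mul_pow, div_pow, Real.sq_sqrt (Nat.cast_nonneg n), one_pow]
          refine mul_le_of_le_one_right (by positivity) ?_
          rw [sq_le_one_iff_abs_le_one]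
          exact hc t
      _ ≤ 1 := by
          rw [Finset.sum_const, Finset.card_range, nsmul_eq_mul, mul_one_div]
          exact div_self_le_one _
  have ha := hsq (fun t => (character θ t).re) fun t =>
    (Complex.abs_re_le_norm _).trans_eq (norm_character _ _)
  have hb := hsq (fun t => (character θ t).im) fun t =>
    (Complex.abs_im_le_norm _).trans_eq (norm_character _ _)
  let U : (ℕ → ℝ) → Ω → EuclideanSpace ℝ (Fin d) := fun c ω =>
    WithLp.toLp 2 fun i => ∑ t ∈ Finset.range n, c t * η t ω i
  have hU : ∀ c, AEStronglyMeasurable (U c) P := by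
    intro c
    have : Measurable (U c) := by
      refine (MeasurableEquiv.toLp 2 (Fin d → ℝ)).measurable.comp
        (measurable_pi_lambda _ fun i => ?_)
      exact Finset.measurable_fun_sum _ fun t _ => (hL.measurable_component t i).const_mul _
    exact this.aestronglyMeasurable
  have hle : ∀ ω, ‖dft n (fun t => η t ω) θ‖ ≤ ‖‖U a ω‖ + ‖U b ω‖‖ := by
    intro ω
    rw [Real.norm_eq_abs, abs_of_nonneg (by positivity)]
    refine abs_le_of_sq_le_sq' ?_ (by positivity) |>.2
    have hre : (WithLp.toLp 2 fun i => (dft n (fun t => η t ω) θ i).re) = U a ω := by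
      ext i
      simp only [dft_apply, U, a, Complex.re_ofReal_mul, Complex.re_sum, Complex.re_mul_ofReal,
        Finset.mul_sum, mul_assoc]
    have him : (WithLp.toLp 2 fun i => (dft n (fun t => η t ω) θ i).im) = U b ω := by
      ext i
      simp only [dft_apply, U, b, Complex.im_ofReal_mul, Complex.im_sum, Complex.im_mul_ofReal,
        Finset.mul_sum, mul_assoc]
    rw [norm_sq_eq_re_add_im, hre, him]
    nlinarith [norm_nonneg (U a ω), norm_nonneg (U b ω),
      mul_nonneg (norm_nonneg (U a ω)) (norm_nonneg (U b ω))]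
  refine (eLpNorm_mono hle).trans ?_
  refine (eLpNorm_add_le (hU a).norm (hU b).norm
    (hk.trans (le_mul_of_one_le_right' (by norm_num)))).trans ?_
  rw [eLpNorm_norm, eLpNorm_norm, two_mul,
    ENNReal.ofReal_add (by have := gaussianNorm_nonneg (k * 2); positivity)
      (by have := gaussianNorm_nonneg (k * 2); positivity)]
  exact add_le_add (hL.eLpNorm_linear_combination_le hG hk hk' n a ha)
    (hL.eLpNorm_linear_combination_le hG hk hk' n b hb)

lemma monotone_boundaryTerm (n : ℕ) (Ψ : ℕ → Matrix (Fin d) (Fin d) ℝ)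
    (y : ℤ → EuclideanSpace ℝ (Fin d)) : Monotone (boundaryTerm n Ψ y) := by
  refine monotone_nat_of_le_succ fun N => ?_
  rw [boundaryTerm, boundaryTerm, Finset.sum_range_succ]
  exact le_add_of_nonneg_right (by positivity)

/-- Minkowski's inequality; the `k` pairs of boundary terms at lag `k` are paid for by the weight `k`
in `∑ₖ k ‖Ψ_k‖`. -/
lemma IsLinearProcess.eLpNorm_boundaryTerm_le (hL : IsLinearProcess P Ψ η X)
    (hG : ∀ t, HasGaussianLaw (η t) P) {k : ℝ≥0∞} (hk : 1 ≤ k) (hk' : k ≠ ∞) (n : ℕ) {K : ℝ}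
    (h : Summable fun k : ℕ => (k : ℝ) * ‖Ψ k‖) (hK : ‖Ψ 0‖ + ∑' k : ℕ, (k : ℝ) * ‖Ψ k‖ ≤ K)
    (N : ℕ) :
    eLpNorm (fun ω => boundaryTerm n Ψ (fun t => η t ω) N) (k * 2) P ≤
      ENNReal.ofReal (K * (2 * (√d * gaussianNorm (k * 2)))) := by
  set g := √d * gaussianNorm (k * 2) with hg
  have hg0 : 0 ≤ g := mul_nonneg (Real.sqrt_nonneg _) (gaussianNorm_nonneg _)
  have hp : 1 ≤ k * 2 := hk.trans (le_mul_of_one_le_right' (by norm_num))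
  have hm : ∀ t, AEStronglyMeasurable (fun ω => ‖η t ω‖) P := fun t =>
    (hL.measurable_innovation t).norm.aestronglyMeasurable
  have hη : ∀ t, eLpNorm (fun ω => ‖η t ω‖) (k * 2) P ≤ ENNReal.ofReal g := fun t => by
    rw [eLpNorm_norm]
    exact hL.eLpNorm_innovation_le hG hk hk' t
  have hin : ∀ i : ℕ, eLpNorm (fun ω => ∑ j ∈ Finset.range i,
      (‖η (-1 - j) ω‖ + ‖η (n - 1 - j) ω‖)) (k * 2) P ≤ ENNReal.ofReal (i * (2 * g)) := by
    intro i
    have e : (fun ω => ∑ j ∈ Finset.range i, (‖η (-1 - j) ω‖ + ‖η (n - 1 - j) ω‖)) =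
        ∑ j ∈ Finset.range i, ((fun ω => ‖η (-1 - j) ω‖) + fun ω => ‖η (n - 1 - j) ω‖) := by
      ext ω; simp
    rw [e]
    refine (eLpNorm_sum_le (fun j _ => (hm _).add (hm _)) hp).trans ?_
    calc _ ≤ ∑ _j ∈ Finset.range i, ENNReal.ofReal (2 * g) := by
          refine Finset.sum_le_sum fun j _ => (eLpNorm_add_le (hm _) (hm _) hp).trans ?_
          rw [two_mul, ENNReal.ofReal_add hg0 hg0]
          exact add_le_add (hη _) (hη _)
      _ = _ := by
          rw [Finset.sum_const, Finset.card_range, nsmul_eq_mul,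
            ENNReal.ofReal_mul (Nat.cast_nonneg i), ENNReal.ofReal_natCast]
  have hm2 : ∀ i : ℕ, AEStronglyMeasurable (fun ω => ‖Ψ i‖ * ∑ j ∈ Finset.range i,
      (‖η (-1 - j) ω‖ + ‖η (n - 1 - j) ω‖)) P := fun i =>
    (Finset.aestronglyMeasurable_fun_sum _ fun j _ => (hm _).add (hm _)).const_mul _
  have e : (fun ω => boundaryTerm n Ψ (fun t => η t ω) N) = ∑ i ∈ Finset.range N, fun ω =>
      ‖Ψ i‖ * ∑ j ∈ Finset.range i, (‖η (-1 - j) ω‖ + ‖η (n - 1 - j) ω‖) := by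
    ext ω; simp [boundaryTerm]
  rw [e]
  refine (eLpNorm_sum_le (fun i _ => hm2 i) hp).trans ?_
  calc _ ≤ ∑ i ∈ Finset.range N, ENNReal.ofReal (i * ‖Ψ i‖ * (2 * g)) := by
        refine Finset.sum_le_sum fun i _ => ?_
        have := eLpNorm_const_smul ‖Ψ i‖ (fun ω => ∑ j ∈ Finset.range i,
          (‖η (-1 - j) ω‖ + ‖η (n - 1 - j) ω‖)) (k * 2) P
        refine (le_of_eq this).trans ?_
        rw [enorm_norm, ← ofReal_norm, mul_comm (i : ℝ), mul_assoc,
          ENNReal.ofReal_mul (norm_nonneg _)]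
        gcongr
        exact hin i
    _ = ENNReal.ofReal (∑ i ∈ Finset.range N, i * ‖Ψ i‖ * (2 * g)) := by
        rw [ENNReal.ofReal_sum_of_nonneg fun i _ => by positivity]
    _ ≤ _ := by
        rw [← Finset.sum_mul]
        gcongr
        refine le_trans ?_ hK
        exact (h.sum_le_tsum _ fun i _ => by positivity).trans
          (le_add_of_nonneg_left (norm_nonneg _))

/-- The boundary terms increase with `N`, so that bounds for each `N` are bounds for all `N` at
once. -/
lemma IsLinearProcess.measure_exists_boundaryTerm_le (hL : IsLinearProcess P Ψ η X)
    (hG : ∀ t, HasGaussianLaw (η t) P) {k : ℕ} (hk : 1 ≤ k) (n : ℕ) {K : ℝ}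
    (h : Summable fun k : ℕ => (k : ℝ) * ‖Ψ k‖) (hK : ‖Ψ 0‖ + ∑' k : ℕ, (k : ℝ) * ‖Ψ k‖ ≤ K)
    {x : ℝ} (hx : 0 < x) :
    P {ω | ∃ N, x ≤ boundaryTerm n Ψ (fun t => η t ω) N} ≤
      ENNReal.ofReal ((K * (2 * (√d * gaussianNorm (k * 2))) / x) ^ (k * 2)) := by
  have hK0 : 0 ≤ K := le_trans (by positivity) hK
  have hg := gaussianNorm_nonneg (k * 2)
  have hmono : Monotone fun N => {ω | x ≤ boundaryTerm n Ψ (fun t => η t ω) N} :=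
    fun N N' hN ω hω => le_trans hω (monotone_boundaryTerm n Ψ _ hN)
  rw [Set.ofPred_exists, hmono.measure_iUnion]
  refine iSup_le fun N => ?_
  have hm : Measurable fun ω => boundaryTerm n Ψ (fun t => η t ω) N := by
    unfold boundaryTerm
    have := hL.measurable_innovation
    fun_prop
  have h1 := measure_le_norm_le (q := k * 2) (by omega) hm.aestronglyMeasurable (a :=
    K * (2 * (√d * gaussianNorm (k * 2)))) (by positivity) hx
    (by
      push_cast
      exact hL.eLpNorm_boundaryTerm_le hG (by exact_mod_cast hk) (ENNReal.natCast_ne_top k) n h hK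
        N)
  refine le_trans (measure_mono fun ω hω => ?_) h1
  rw [Set.mem_ofPred_eq] at hω ⊢
  exact hω.trans (le_abs_self _)

lemma IsLinearProcess.measure_norm_dft_le [IsProbabilityMeasure P]
    (hL : IsLinearProcess P Ψ η X)
    (hG : ∀ t, HasGaussianLaw (η t) P) {k : ℕ} (hk : 1 ≤ k) (n : ℕ) (θ : ℝ) {x : ℝ} (hx : 0 < x) :
    P {ω | x ≤ ‖dft n (fun t => η t ω) θ‖} ≤
      ENNReal.ofReal ((2 * (√d * gaussianNorm (k * 2)) / x) ^ (k * 2)) := by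
  have hg := gaussianNorm_nonneg (k * 2)
  have hm : Measurable fun ω => dft n (fun t => η t ω) θ := by
    have := hL.measurable_innovation
    have := (continuous_complexify (d := d)).measurable
    unfold dft
    fun_prop
  exact measure_le_norm_le (q := k * 2) (by omega) hm.aestronglyMeasurable (by positivity) hx
    (by
      push_cast
      exact hL.eLpNorm_dft_le hG (by exact_mod_cast hk) (ENNReal.natCast_ne_top k) n θ)

end Gaussian

/-! ### The probability bound at fixed sample size -/

/-- The right-hand side bounds the probability that the boundary terms or one of the `n` transforms
of the innovations reach `√d x`; otherwise the deterministic comparison applies, in which `d` cancels.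
The event on the left need not be shown measurable, as only its outer measure is bounded. -/
lemma IsLinearProcess.measureReal_iSup_dBL_le {Ω : Type*} [MeasurableSpace Ω] {P : Measure Ω}
    [IsProbabilityMeasure P] {d n m : ℕ} {Ψ : ℕ → Matrix (Fin d) (Fin d) ℝ}
    {η X : ℤ → Ω → EuclideanSpace ℝ (Fin d)} (hL : IsLinearProcess P Ψ η X)
    (hG : ∀ t, HasGaussianLaw (η t) P) (hd : 0 < d) (hnm : 2 * m + 1 ≤ n) {K : ℝ}
    (h : Summable fun k : ℕ => (k : ℝ) * ‖Ψ k‖) (hK : ‖Ψ 0‖ + ∑' k : ℕ, (k : ℝ) * ‖Ψ k‖ ≤ K)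
    {k : ℕ} (hk : 1 ≤ k) {x τ : ℝ} (hx : 0 < x)
    (hτ : x ^ 2 * ((2 * K + (1 / √n + K * (2 * Real.pi * m / n))) *
      (1 / √n + K * (2 * Real.pi * m / n))) < τ) :
    P.real {ω | τ ≤ ⨆ r : Fin n, dBL
        (esd (daniell n m (fun t => X t ω) (2 * Real.pi * (r : ℕ) / n)))
        (esd (approximant n m Ψ (fun t => η t ω) r))} ≤
      (2 * K * gaussianNorm (k * 2) / x) ^ (k * 2) +
        n * (2 * gaussianNorm (k * 2) / x) ^ (k * 2) := by
  have hK0 : 0 ≤ K := le_trans (by positivity) hK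
  have hg := gaussianNorm_nonneg (k * 2)
  set g := gaussianNorm (k * 2) with hg_def
  have hd' : 0 < √(d : ℝ) := Real.sqrt_pos.2 (by exact_mod_cast hd)
  have hn : Nonempty (Fin n) := ⟨⟨0, by omega⟩⟩
  have hlim : ∀ᵐ ω ∂P, ∀ t, Tendsto
      (fun N : ℕ => ∑ k ∈ Finset.range N, Matrix.toEuclideanLin (Ψ k) (η (t - (k : ℤ)) ω))
      atTop (𝓝 (X t ω)) := ae_all_iff.2 hL.hasLimit
  refine ENNReal.toReal_le_of_le_ofReal (by positivity) ?_
  have hsub : {ω | τ ≤ ⨆ r : Fin n, dBL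
        (esd (daniell n m (fun t => X t ω) (2 * Real.pi * (r : ℕ) / n)))
        (esd (approximant n m Ψ (fun t => η t ω) r))} ⊆
      {ω | ¬ ∀ t, Tendsto
        (fun N : ℕ => ∑ k ∈ Finset.range N, Matrix.toEuclideanLin (Ψ k) (η (t - (k : ℤ)) ω))
        atTop (𝓝 (X t ω))} ∪
      ({ω | ∃ N, √d * x ≤ boundaryTerm n Ψ (fun t => η t ω) N} ∪
        ⋃ l ∈ Finset.range n, {ω | √d * x ≤ ‖dft n (fun t => η t ω) (frequency n (l : ℕ))‖}) := by
    intro ω hω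
    by_contra hbad
    simp only [Set.mem_union, not_or, Set.mem_ofPred_eq, not_not, Set.mem_iUnion, not_exists,
      not_le, Finset.mem_range] at hbad hω
    obtain ⟨hX, hB, hA⟩ := hbad
    refine absurd (hω.trans (ciSup_le fun r => ?_)) (not_le.2 hτ)
    refine (dBL_daniell_approximant_le (η := fun t => η t ω) (X := fun t => X t ω) hnm h hK hX
      (fun N => (hB N).le)
      (fun l hl => (hA l hl).le) r).trans_eq ?_
    have hdd : √(d : ℝ) * √d = d := Real.mul_self_sqrt (Nat.cast_nonneg d)
    have hd0 : (d : ℝ) ≠ 0 := by exact_mod_cast hd.ne'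
    rw [inv_mul_eq_iff_eq_mul₀ hd0]
    calc _ = √d * √d * (x ^ 2 * ((2 * K + (1 / √n + K * (2 * Real.pi * m / n))) *
          (1 / √n + K * (2 * Real.pi * m / n)))) := by ring
      _ = _ := by rw [hdd]
  have e1 : K * (2 * (√d * g)) / (√d * x) = 2 * K * g / x := by field_simp
  have e2 : 2 * (√d * g) / (√d * x) = 2 * g / x := by field_simp
  refine (measure_mono hsub).trans ((measure_union_le _ _).trans ?_)
  rw [ae_iff.1 hlim, zero_add, ENNReal.ofReal_add (by positivity) (by positivity)]
  refine (measure_union_le _ _).trans (add_le_add ?_ ?_)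
  · refine (hL.measure_exists_boundaryTerm_le hG hk n h hK (mul_pos hd' hx)).trans_eq ?_
    rw [← hg_def, e1]
  · refine (measure_biUnion_finset_le _ _).trans ?_
    calc _ ≤ ∑ _l ∈ Finset.range n, ENNReal.ofReal ((2 * g / x) ^ (k * 2)) := by
          refine Finset.sum_le_sum fun l _ =>
            (hL.measure_norm_dft_le hG hk n _ (mul_pos hd' hx)).trans_eq ?_
          rw [← hg_def, e2]
      _ = _ := by
          rw [Finset.sum_const, Finset.card_range, nsmul_eq_mul,
            ENNReal.ofReal_mul (Nat.cast_nonneg n), ENNReal.ofReal_natCast]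

/-! ### Exponents -/

/-- The rate `n^{max(-1/2, α-1)}` beats the claimed one by at least the factor `n^{δ/(1+γ)}`. For
`α ≤ 1/2` this is due to `(γ - 1) α / (γ + 1) ≤ 1/2`. -/
lemma exponent_le {α γ δ : ℝ} (hα : 0 < α) (hγ : 1 < γ) (hδ : 0 < δ) :
    max (-1 / 2) (α - 1) + δ / (1 + γ) ≤ max ((δ + (1 - γ) * α) / (1 + γ)) (δ + α - 1) := by
  have hγ' : 0 < 1 + γ := by linarith
  have hδγ : δ / (1 + γ) ≤ δ := div_le_self hδ.le (by linarith)
  rcases le_total (α - 1) (-1 / 2) with h | h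
  · rw [max_eq_left h]
    refine le_trans ?_ (le_max_left _ _)
    have : -1 / 2 ≤ (1 - γ) * α / (1 + γ) := by
      rw [le_div_iff₀ hγ']
      nlinarith
    rw [add_div]
    linarith
  · rw [max_eq_right h]
    refine le_trans ?_ (le_max_right _ _)
    linarith

/-- For large `n` the window is not longer than the period, and a small power of `n` absorbs the
constants. -/
lemma eventually_large {α K₁ a b ε : ℝ} (hα' : 0 < α) (hα : α < 1) (hε : 0 < ε) (hb : 0 < b) :
    ∀ᶠ n : ℕ in atTop, 2 * K₁ * (n : ℝ) ^ α + 1 ≤ n ∧ a < b * (n : ℝ) ^ ε := by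
  have h1 : Tendsto (fun n : ℕ => (n : ℝ) ^ (1 - α)) atTop atTop :=
    (tendsto_rpow_atTop (by linarith)).comp tendsto_natCast_atTop_atTop
  have h2 : Tendsto (fun n : ℕ => b * (n : ℝ) ^ ε) atTop atTop :=
    ((tendsto_rpow_atTop hε).comp tendsto_natCast_atTop_atTop).const_mul_atTop hb
  have h3 : Tendsto (fun n : ℕ => (n : ℝ) ^ α * ((n : ℝ) ^ (1 - α) - 2 * K₁)) atTop atTop :=
    ((tendsto_rpow_atTop hα').comp tendsto_natCast_atTop_atTop).atTop_mul_atTop₀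
      (tendsto_atTop_add_const_right _ (-(2 * K₁)) h1)
  filter_upwards [h3.eventually_ge_atTop 1, h2.eventually_gt_atTop a, eventually_ge_atTop 1]
    with n hn1 hn2 hn3
  have hn : (0 : ℝ) < n := by exact_mod_cast hn3
  refine ⟨?_, hn2⟩
  rw [mul_sub, ← Real.rpow_add hn, add_sub_cancel, Real.rpow_one] at hn1
  linarith

end DaniellPeriodogram

end

theorem mainTheorem3
    (α γ K₁ K₂ : ℝ) (hα_pos : 0 < α) (hα_lt_one : α < 1) (hγ : 1 < γ)
    (hK₁ : 0 < K₁) (hK₂ : 0 < K₂) (δ D : ℝ) (hδ : 0 < δ) (hD : 0 < D) :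
    ∃ C : ℝ, 0 < C ∧
      ∀ (Ω : Type*) [MeasurableSpace Ω] (P : Measure Ω) [IsProbabilityMeasure P]
        (d m : ℕ → ℕ)
        (Ψ : (n : ℕ) → ℕ → Matrix (Fin (d n)) (Fin (d n)) ℝ)
        (η X : (n : ℕ) → ℤ → Ω → EuclideanSpace ℝ (Fin (d n))),
        (∀ n : ℕ, 1 ≤ n → DaniellPeriodogram.IsLinearProcess P (Ψ n) (η n) (X n)) →
        (∀ n : ℕ, 1 ≤ n → ∀ t : ℤ, HasGaussianLaw (η n t) P) →
        DaniellPeriodogram.AssumptionA1 α K₁ d m →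
        DaniellPeriodogram.AssumptionA2 γ K₂ Ψ →
        DaniellPeriodogram.AssumptionA3 P X →
        ∀ n : ℕ, 1 ≤ n →
          P.real {ω | (48 * K₂ + 20 * K₂ ^ 2) *
                (n : ℝ) ^ max ((δ + (1 - γ) * α) / (1 + γ)) (δ + α - 1) ≤
              ⨆ r : Fin n, DaniellPeriodogram.dBL
                (DaniellPeriodogram.esd
                  (DaniellPeriodogram.daniell n (m n) (fun t => X n t ω)
                    (2 * Real.pi * (r : ℕ) / n)))
                (DaniellPeriodogram.esd
                  (DaniellPeriodogram.approximant n (m n) (Ψ n) (fun t => η n t ω) r))}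
            ≤ C * (n : ℝ) ^ (-D) := by
  -- Deviations by a factor `n ^ ε` enter squared and use half of the slack in the exponent; the
  -- other half absorbs the constants.
  set ε := δ / (1 + γ) / 4 with hε_def
  have hε : 0 < ε := by positivity
  set c := 1 + K₂ * (2 * Real.pi * K₁) with hc
  have hc0 : 0 < c := by positivity
  have hb : 0 < 48 * K₂ + 20 * K₂ ^ 2 := by positivity
  obtain ⟨n₀, hn₀⟩ := eventually_atTop.1 (DaniellPeriodogram.eventually_large (K₁ := K₁)
    (a := (2 * K₂ + c) * c) hα_pos hα_lt_one (mul_pos two_pos hε) hb)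
  -- Moments of order `2k` turn deviations by a factor `n ^ ε` into probabilities `n ^ (-(D + 1))`.
  obtain ⟨k, hk⟩ := exists_nat_ge (max 1 ((D + 1) / (2 * ε)))
  have hk1 : 1 ≤ k := by exact_mod_cast (le_max_left _ _).trans hk
  have hkD : D + 1 ≤ ε * (k * 2 : ℕ) := by
    have := (div_le_iff₀ (by positivity)).1 ((le_max_right _ _).trans hk)
    push_cast
    linarith
  have hg := DaniellPeriodogram.gaussianNorm_nonneg (k * 2)
  set g := DaniellPeriodogram.gaussianNorm (k * 2) with hg_def
  refine ⟨(2 * K₂ * g) ^ (k * 2) + (2 * g) ^ (k * 2) + (max n₀ 1 : ℕ) ^ D, by positivity, ?_⟩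
  intro Ω _ P _ d m Ψ η X hL hG hA1 hA2 _ n hn
  have hn0 : (0 : ℝ) < n := by exact_mod_cast hn
  have hn1 : (1 : ℝ) ≤ n := by exact_mod_cast hn
  rcases lt_or_ge n n₀ with hlt | hge
  -- For small `n` the claimed bound is at least one.
  · refine measureReal_le_one.trans ?_
    have h1 : (1 : ℝ) ≤ ((max n₀ 1 : ℕ) : ℝ) ^ D * (n : ℝ) ^ (-D) := by
      rw [Real.rpow_neg hn0.le, ← div_eq_mul_inv, one_le_div (by positivity)]
      gcongr
      exact_mod_cast hlt.le.trans (le_max_left _ _)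
    refine h1.trans ?_
    gcongr
    exact le_add_of_nonneg_left (by positivity)
  · obtain ⟨hlarge1, hlarge2⟩ := hn₀ n hge
    have hd : 0 < d n := by
      have h1 := (hA1.dim_bounds n hn).1
      by_contra h0
      rw [not_lt, Nat.le_zero] at h0
      rw [h0, Nat.cast_zero, zero_div] at h1
      exact absurd h1 (not_le.2 (by positivity))
    have hm : (m n : ℝ) ≤ K₁ * (n : ℝ) ^ α :=
      (div_le_iff₀ (by positivity)).1 (hA1.band_bounds n hn).2
    have hnm : 2 * m n + 1 ≤ n := by
      have : (2 * m n + 1 : ℝ) ≤ n := by linarith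
      exact_mod_cast this
    set β := max (-1 / 2) (α - 1) with hβ
    have hβ0 : (n : ℝ) ^ β ≤ 1 :=
      Real.rpow_le_one_of_one_le_of_nonpos hn1 (max_le (by norm_num) (by linarith))
    have hs : 1 / √(n : ℝ) + K₂ * (2 * Real.pi * m n / n) ≤ c * (n : ℝ) ^ β := by
      have h1 : 1 / √(n : ℝ) ≤ (n : ℝ) ^ β := by
        rw [Real.sqrt_eq_rpow, one_div, ← Real.rpow_neg hn0.le]
        exact Real.rpow_le_rpow_of_exponent_le hn1 (by rw [hβ]; norm_num)
      have h2 : (m n : ℝ) / n ≤ K₁ * (n : ℝ) ^ β := by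
        calc (m n : ℝ) / n ≤ K₁ * (n : ℝ) ^ α / n := by gcongr
          _ = K₁ * (n : ℝ) ^ (α - 1) := by rw [Real.rpow_sub_one hn0.ne']; ring
          _ ≤ _ := by
            gcongr
            exact le_max_right _ _
      calc _ = 1 / √(n : ℝ) + K₂ * (2 * Real.pi) * (m n / n) := by ring
        _ ≤ (n : ℝ) ^ β + K₂ * (2 * Real.pi) * (K₁ * (n : ℝ) ^ β) := by gcongr
        _ = _ := by rw [hc]; ring
    have hx2 : ((n : ℝ) ^ ε) ^ 2 = (n : ℝ) ^ (2 * ε) := by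
      rw [← Real.rpow_natCast, ← Real.rpow_mul hn0.le]
      congr 1
      push_cast
      ring
    have hτ : ((n : ℝ) ^ ε) ^ 2 * ((2 * K₂ + (1 / √(n : ℝ) + K₂ * (2 * Real.pi * m n / n))) *
        (1 / √(n : ℝ) + K₂ * (2 * Real.pi * m n / n))) < (48 * K₂ + 20 * K₂ ^ 2) *
          (n : ℝ) ^ max ((δ + (1 - γ) * α) / (1 + γ)) (δ + α - 1) := by
      have hexp : β + (2 * ε + 2 * ε) ≤ max ((δ + (1 - γ) * α) / (1 + γ)) (δ + α - 1) := by
        have := DaniellPeriodogram.exponent_le hα_pos hγ hδ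
        rw [← hβ] at this
        linarith
      calc _ ≤ (n : ℝ) ^ (2 * ε) * ((2 * K₂ + c) * (c * (n : ℝ) ^ β)) := by
            rw [hx2]
            gcongr
            exact hs.trans (mul_le_of_le_one_right hc0.le hβ0)
        _ = ((2 * K₂ + c) * c) * ((n : ℝ) ^ (2 * ε) * (n : ℝ) ^ β) := by ring
        _ < ((48 * K₂ + 20 * K₂ ^ 2) * (n : ℝ) ^ (2 * ε)) *
            ((n : ℝ) ^ (2 * ε) * (n : ℝ) ^ β) := by gcongr
        _ = (48 * K₂ + 20 * K₂ ^ 2) * (n : ℝ) ^ (β + (2 * ε + 2 * ε)) := by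
            rw [Real.rpow_add hn0, Real.rpow_add hn0]; ring
        _ ≤ _ := by gcongr
    refine ((hL n hn).measureReal_iSup_dBL_le (hG n hn) hd hnm (hA2.summable n hn)
      (hA2.weighted_bound n hn) hk1 (Real.rpow_pos_of_pos hn0 ε) hτ).trans ?_
    have hpow : (((n : ℝ) ^ ε) ^ (k * 2))⁻¹ ≤ (n : ℝ) ^ (-(D + 1)) := by
      rw [← Real.rpow_natCast, ← Real.rpow_mul hn0.le, ← Real.rpow_neg hn0.le]
      exact Real.rpow_le_rpow_of_exponent_le hn1 (neg_le_neg hkD)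
    have hpow1 : (n : ℝ) * (n : ℝ) ^ (-(D + 1)) = (n : ℝ) ^ (-D) := by
      rw [← Real.rpow_one_add' hn0.le (by linarith)]
      congr 1
      ring
    have hpow2 : (n : ℝ) ^ (-(D + 1)) ≤ (n : ℝ) ^ (-D) :=
      Real.rpow_le_rpow_of_exponent_le hn1 (by linarith)
    rw [div_pow, div_pow, div_eq_mul_inv, div_eq_mul_inv]
    calc _ ≤ (2 * K₂ * g) ^ (k * 2) * (n : ℝ) ^ (-D) +
          n * ((2 * g) ^ (k * 2) * (n : ℝ) ^ (-(D + 1))) := by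
          gcongr
          exact hpow.trans hpow2
      _ = ((2 * K₂ * g) ^ (k * 2) + (2 * g) ^ (k * 2)) * (n : ℝ) ^ (-D) := by
          rw [← hpow1]; ring
      _ ≤ _ := by
          refine mul_le_mul_of_nonneg_right ?_ (by positivity)
          exact le_add_of_nonneg_right (by positivity)
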